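/- Let $0<t<1$. For complex $z$ let $$K(z,t)=\int_0^z\frac{dx}{\sqrt{1-x^2}\,\sqrt{1-t^2x^2}}$$ be the normal elliptic integral of the first kind (integral along the segment from $0$ to $z$, principal square roots), and put $$\mu(t)=\frac{\pi K(1,\sqrt{1-t^2})}{2K(1,t)},\qquad f_t(z)=\sin\Big(\frac{\pi}{2K(1,t)}K\big(z/\sqrt t,\,t\big)\Big)\quad(|z|<1).$$ Then $f_t$ is the conformal map (holomorphic bijection) of the unit disc $\{|z|<1\}$ onto the elliptical region $$V_\xi=\Big\{x+iy:\ \frac{x^2}{\cosh^2\xi}+\frac{y^2}{\sinh^2\xi}<1\Big\},\qquad \xi=\mu(t)/2,$$ with $f_t(0)=0$ and $f_t'(0)>0$. Its Taylor coefficients at $0$ are real and those of even order vanish, so that $f_t(z)=\sum_{n=0}^\infty A_n(t)z^{2n+1}$ for $|z|<1$, where $A_n(t)$ is the Taylor coefficient of order $2n+1$. Moreover both of the following series converge, with $$\sum_{n=0}^\infty A_n(t)^2=\frac{\sinh^2\mu(t)}{2\cosh\mu(t)},\qquad \sum_{n=0}^\infty\Big(\sum_{j=0}^n A_j(t)A_{n-j}(t)\Big)^2=\frac{\sinh^4\mu(t)}{2\cosh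 2\mu(t)}.$$ -/

import Mathlib

noncomputable section

/-- The complete elliptic integral `K(1,t) = ∫₀¹ dx / √((1-x²)(1-t²x²))` as a real number
(an absolutely convergent integral for `0 < t < 1`). -/
def completeEllipticK (t : ℝ) : ℝ :=
  ∫ x in (0 : ℝ)..1, 1 / √((1 - x ^ 2) * (1 - t ^ 2 * x ^ 2))

/-- The normal elliptic integral of the first kind
`K(z,t) = ∫₀ᶻ dx / (√(1-x²) √(1-t²x²))` for complex `z`, taken along the segment `x = s z`,
`0 ≤ s ≤ 1`, with principal square roots. -/
def ellipticK (z : ℂ) (t : ℝ) : ℂ :=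
  ∫ s in (0 : ℝ)..1,
    z / ((1 - ((s : ℂ) * z) ^ 2) ^ (1 / 2 : ℂ) *
      (1 - (t : ℂ) ^ 2 * ((s : ℂ) * z) ^ 2) ^ (1 / 2 : ℂ))

theorem ellipticK_one {t : ℝ} (ht0 : 0 < t) (ht1 : t < 1) :
    ellipticK 1 t = (completeEllipticK t : ℂ) := by
  unfold ellipticK completeEllipticK
  rw [← intervalIntegral.integral_ofReal]
  refine intervalIntegral.integral_congr fun s hs => ?_
  rw [Set.uIcc_of_le zero_le_one] at hs
  have h1 : 0 ≤ 1 - s ^ 2 := by nlinarith [hs.1, hs.2]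
  have h2 : 0 ≤ 1 - t ^ 2 * s ^ 2 := by
    have : t ^ 2 ≤ 1 := by nlinarith
    nlinarith [sq_nonneg s]
  have e1 : (1 - ((s : ℂ) * 1) ^ 2) ^ (1 / 2 : ℂ) = ((√(1 - s ^ 2) : ℝ) : ℂ) := by
    rw [Real.sqrt_eq_rpow, Complex.ofReal_cpow h1]; push_cast; simp
  have e2 : (1 - (t : ℂ) ^ 2 * ((s : ℂ) * 1) ^ 2) ^ (1 / 2 : ℂ)
      = ((√(1 - t ^ 2 * s ^ 2) : ℝ) : ℂ) := by
    rw [Real.sqrt_eq_rpow, Complex.ofReal_cpow h2]; push_cast; simp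
  simp only [e1, e2, Real.sqrt_mul h1]
  push_cast
  rfl

/-- The modulus `μ(t) = π K(1,√(1-t²)) / (2 K(1,t))`. -/
def ellipticMu (t : ℝ) : ℝ :=
  Real.pi * completeEllipticK √(1 - t ^ 2) / (2 * completeEllipticK t)

/-- The elliptic region `V_ξ` with foci `±1` and semi-axes `cosh ξ`, `sinh ξ`. -/
def ellipseRegion (ξ : ℝ) : Set ℂ :=
  {z | z.re ^ 2 / Real.cosh ξ ^ 2 + z.im ^ 2 / Real.sinh ξ ^ 2 < 1}

/-- The map `f_{0,t}(z) = sin (π / (2 K(1,t)) · K(z/√t, t))`. -/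
def ellipseMap (t : ℝ) (z : ℂ) : ℂ :=
  Complex.sin ((Real.pi : ℂ) / (2 * ellipticK 1 t) * ellipticK (z / (√t : ℝ)) t)

/-- The `n`-th Taylor coefficient `a_n(t)` of `f_{0,t}` at the origin. -/
def ellipseCoeff (t : ℝ) (n : ℕ) : ℂ :=
  iteratedDeriv n (ellipseMap t) 0 / (n.factorial : ℂ)

/-- `A_n(t) = a_{2n+1}(t)`, as a real number. -/
def ellipseA (t : ℝ) (n : ℕ) : ℝ :=
  (ellipseCoeff t (2 * n + 1)).re

end

open Set Filter Topology MeasureTheory Complex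
open scoped Real ComplexConjugate Interval

noncomputable section

/-! Put `x = z / √t` and `c = π / (2 K(1,t))`. On the part of the open first quadrant with `|x| ≤
1/√t`, the integral `K(·,t)` takes values in the strip `0 < Re < K(1,t)`. It is injective there,
because its derivative has positive imaginary part. Along the arc `|x| = 1/√t` its imaginary part is
constant, since `x K'(x)` is purely imaginary there; inside the arc the imaginary part is smaller.
The constant is `Im K(i/√t, t)`, half the complete integral of the complementary modulus, so `c`
times it is `ξ = μ/2`. As `sin` takes the line `Im = ξ` to the ellipse with semi-axes `cosh ξ`,
`sinh ξ`, the arc of the unit circle lands on the boundary of `V_ξ` and the open quarter disc inside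
`V_ξ`.

`K` branches at `x = ±1`, which may lie inside the disc. Writing `x = 1 - v²` gives `K(x) = K(1) -
L(v)` with `L` odd and holomorphic at `v = 0` (`coEllipticK`). Hence `sin (c K(x)) = cos (c L(v))`
is even in `v`, and so holomorphic in `x` across `1`. Therefore `f_t` is holomorphic on `|z| <
1/√t`, past the closed unit disc.

The symmetries `z ↦ -z` and `z ↦ conj z` carry the quadrant results to all points off the axes; the
axes follow by continuity and the open mapping theorem. The image is open, and closed relative to
the ellipse because the circle goes to the boundary, so connectedness gives surjectivity.

By Parseval the two sums are the means of `|f|²` and `|f²|²` over the unit circle. On the boundary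
ellipse `|w|²` and `|w|⁴` equal real parts of polynomials in `w`, so both means are values at `0` of
harmonic functions, read off from `f(0) = 0`. -/

/-! ### Parseval's identity on the unit circle -/

theorem hasSum_integral_circle {F : ℕ → ℝ → ℂ} {f : ℝ → ℂ} {c : ℕ → ℝ} (hc : Summable c)
    (hF : ∀ n, Continuous (F n)) (hb : ∀ n θ, ‖F n θ‖ ≤ c n)
    (hs : ∀ θ, HasSum (fun n => F n θ) (f θ)) :
    HasSum (fun n => ∫ θ in (0 : ℝ)..2 * π, F n θ) (∫ θ in (0 : ℝ)..2 * π, f θ) :=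
  intervalIntegral.hasSum_integral_of_dominated_convergence (fun n _ => c n)
    (fun n => (hF n).aestronglyMeasurable) (fun n => ae_of_all _ fun θ _ => hb n θ)
    (ae_of_all _ fun _ _ => hc) (by simp) (ae_of_all _ fun θ _ => hs θ)

theorem integral_circleMap_pow_mul_conj_pow (m n : ℕ) :
    ∫ θ in (0 : ℝ)..2 * π, circleMap 0 1 θ ^ m * conj (circleMap 0 1 θ ^ n)
      = if m = n then ((2 * π : ℝ) : ℂ) else 0 := by
  have key : ∀ θ : ℝ, circleMap 0 1 θ ^ m * conj (circleMap 0 1 θ ^ n)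
      = exp (((m : ℂ) - n) * I * θ) := by
    intro θ
    simp only [circleMap, zero_add, ofReal_one, one_mul, ← exp_conj, map_mul, conj_I,
      conj_ofReal, ← exp_nat_mul, ← exp_add, Complex.conj_natCast]
    congr 1
    ring
  simp only [key]
  split_ifs with h
  · subst h; simp
  · have hne : ((m : ℂ) - n) * I ≠ 0 := by
      simpa [sub_eq_zero] using h
    rw [integral_exp_mul_complex hne]
    have : ((m : ℂ) - n) * I * ((2 * π : ℝ) : ℂ) = ((m - n : ℤ) : ℂ) * (2 * π * I) := by
      push_cast; ring
    rw [this, exp_int_mul_two_pi_mul_I]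
    simp

/-- Absolute convergence on the circle itself permits termwise integration, first to extract each
coefficient and then to expand `conj g`. The injective exponent map `e` lets series in odd or even
powers be used directly. -/
theorem hasSum_sq_norm_coeff {b : ℕ → ℂ} {e : ℕ → ℕ} (he : Function.Injective e)
    (hb : Summable fun n => ‖b n‖) {g : ℂ → ℂ}
    (hg : ∀ z ∈ Metric.sphere (0 : ℂ) 1, HasSum (fun n => b n * z ^ e n) (g z)) :
    HasSum (fun n => ‖b n‖ ^ 2) (Real.circleAverage (fun z => ‖g z‖ ^ 2) 0 1) := by
  have hg' : ∀ θ : ℝ, HasSum (fun n => b n * circleMap 0 1 θ ^ e n) (g (circleMap 0 1 θ)) :=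
    fun θ => hg _ (circleMap_mem_sphere 0 zero_le_one θ)
  have hcont : Continuous fun θ : ℝ => g (circleMap 0 1 θ) := by
    have : (fun θ : ℝ => g (circleMap 0 1 θ)) = fun θ => ∑' n, b n * circleMap 0 1 θ ^ e n :=
      funext fun θ => (hg' θ).tsum_eq.symm
    rw [this]
    refine continuous_tsum (fun n => by fun_prop) hb fun n θ => ?_
    simp
  have h1 : ∀ n, ∫ θ in (0 : ℝ)..2 * π, g (circleMap 0 1 θ) * conj (circleMap 0 1 θ ^ e n)
      = b n * ((2 * π : ℝ) : ℂ) := by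
    intro n
    have := hasSum_integral_circle (F := fun m θ => b m * circleMap 0 1 θ ^ e m *
      conj (circleMap 0 1 θ ^ e n)) hb (fun m => Continuous.mul (by fun_prop) (continuous_conj.comp (by fun_prop)))
      (fun m θ => by simp)
      (fun θ => (hg' θ).mul_right _)
    simp only [mul_assoc, intervalIntegral.integral_const_mul,
      integral_circleMap_pow_mul_conj_pow, he.eq_iff] at this
    refine this.unique ?_
    convert hasSum_ite_eq n (b n * ((2 * π : ℝ) : ℂ)) using 2 with m
    split_ifs with h <;> simp [h]
  obtain ⟨C, hC⟩ : ∃ C, ∀ θ : ℝ, ‖g (circleMap 0 1 θ)‖ ≤ C := by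
    refine ⟨∑' n, ‖b n‖, fun θ => ?_⟩
    rw [← (hg' θ).tsum_eq]
    refine (norm_tsum_le_tsum_norm ?_).trans (le_of_eq ?_) <;> simp [hb]
  have h2 := hasSum_integral_circle (c := fun n => C * ‖b n‖)
    (F := fun n θ => g (circleMap 0 1 θ) * conj (b n * circleMap 0 1 θ ^ e n))
    (f := fun θ => g (circleMap 0 1 θ) * conj (g (circleMap 0 1 θ))) (hb.mul_left _)
    (fun n => hcont.mul (continuous_conj.comp (by fun_prop)))
    (fun n θ => by simpa using mul_le_mul_of_nonneg_right (hC θ) (norm_nonneg (b n)))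
    (fun θ => ((hasSum_conj'.2 (hg' θ))).mul_left _)
  have h3 : ∀ n, ∫ θ in (0 : ℝ)..2 * π,
      g (circleMap 0 1 θ) * conj (b n * circleMap 0 1 θ ^ e n)
      = (((2 * π) * ‖b n‖ ^ 2 : ℝ) : ℂ) := by
    intro n
    have : ∀ θ : ℝ, g (circleMap 0 1 θ) * conj (b n * circleMap 0 1 θ ^ e n)
      = conj (b n) * (g (circleMap 0 1 θ) * conj (circleMap 0 1 θ ^ e n)) := by
      intro θ; rw [map_mul]; ring
    simp only [this, intervalIntegral.integral_const_mul, h1]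
    push_cast
    rw [← mul_conj']
    ring
  simp only [h3, mul_conj'] at h2
  have h4 : ∫ θ in (0 : ℝ)..2 * π, (‖g (circleMap 0 1 θ)‖ : ℂ) ^ 2
      = ((∫ θ in (0 : ℝ)..2 * π, ‖g (circleMap 0 1 θ)‖ ^ 2 : ℝ) : ℂ) := by
    rw [← intervalIntegral.integral_ofReal]
    push_cast
    rfl
  rw [h4, hasSum_ofReal] at h2
  have h5 := h2.mul_left (2 * π)⁻¹
  simp only [Real.circleAverage_def, smul_eq_mul]
  simpa only [inv_mul_cancel_left₀ Real.two_pi_pos.ne'] using h5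

/-! ### Primitives defined by integration along a segment -/

theorem hasDerivAt_integral_segment {U : Set ℂ} (hU : IsOpen U) {g : ℂ → ℂ}
    (hg : DifferentiableOn ℂ g U) {v₀ : ℂ} (hv : ∀ r ∈ Icc (0 : ℝ) 1, (r : ℂ) * v₀ ∈ U) :
    HasDerivAt (fun v => ∫ r in (0 : ℝ)..1, v * g (r * v)) (g v₀) v₀ := by
  set S : Set ℂ := (fun r : ℝ => (r : ℂ) * v₀) '' Icc 0 1 with hS
  have hSc : IsCompact S := isCompact_Icc.image (by fun_prop)
  have hSU : S ⊆ U := by rintro _ ⟨r, hr, rfl⟩; exact hv r hr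
  -- A compact thickening of the segment contains the segments to all nearby `v`, and `g` and `g'`
  -- are bounded on it: this supplies the dominating constant.
  obtain ⟨δ, hδ, hδU⟩ := hSc.exists_cthickening_subset_open hU hSU
  have hTc : IsCompact (Metric.cthickening δ S) := hSc.cthickening
  have hmem : ∀ r ∈ Icc (0 : ℝ) 1, ∀ v ∈ Metric.ball v₀ δ,
      (r : ℂ) * v ∈ Metric.cthickening δ S := by
    intro r hr v hv'
    refine Metric.mem_cthickening_of_dist_le _ ((r : ℂ) * v₀) _ _ ⟨r, hr, rfl⟩ ?_
    rw [dist_eq_norm, ← mul_sub, norm_mul, norm_real, Real.norm_eq_abs, abs_of_nonneg hr.1]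
    have := (mem_ball_iff_norm.1 hv').le
    nlinarith [hr.1, hr.2, norm_nonneg (v - v₀)]
  have hg' : DifferentiableOn ℂ (deriv g) U := hg.deriv hU
  obtain ⟨M, hM⟩ := hTc.exists_bound_of_continuousOn (hg.continuousOn.mono hδU)
  obtain ⟨M', hM'⟩ := hTc.exists_bound_of_continuousOn (hg'.continuousOn.mono hδU)
  have hcI : ∀ v ∈ Metric.ball v₀ δ, ∀ G : ℂ → ℂ, ContinuousOn G U →
      ContinuousOn (fun r : ℝ => G (r * v)) (Icc 0 1) := fun v hv' G hG =>
    hG.comp (by fun_prop) fun r hr => hδU (hmem r hr v hv')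
  have huI : Ι (0 : ℝ) 1 = Ioc 0 1 := uIoc_of_le zero_le_one
  have hmeas : ∀ G : ℝ → ℂ, ContinuousOn G (Icc 0 1) →
      AEStronglyMeasurable G (volume.restrict (Ι (0 : ℝ) 1)) := fun G hG => by
    rw [huI]
    exact (hG.mono Ioc_subset_Icc_self).aestronglyMeasurable measurableSet_Ioc
  have hv₀ : v₀ ∈ Metric.ball v₀ δ := Metric.mem_ball_self hδ
  have c1 := hcI v₀ hv₀ g hg.continuousOn
  have c2 := hcI v₀ hv₀ _ hg'.continuousOn
  have main := intervalIntegral.hasDerivAt_integral_of_dominated_loc_of_deriv_le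
    (μ := volume) (a := (0 : ℝ)) (b := 1) (F := fun v r => v * g (r * v))
    (F' := fun v r => g (r * v) + v * (deriv g (r * v) * r)) (x₀ := v₀) (s := Metric.ball v₀ δ)
    (bound := fun _ => M + (‖v₀‖ + δ) * M') (Metric.ball_mem_nhds _ hδ)
    (by
      filter_upwards [Metric.ball_mem_nhds v₀ hδ] with v hv'
      exact hmeas _ (continuousOn_const.mul (hcI v hv' g hg.continuousOn)))
    (by
      refine ContinuousOn.intervalIntegrable ?_
      rw [uIcc_of_le zero_le_one]
      exact continuousOn_const.mul c1)
    (hmeas _ (c1.add (continuousOn_const.mul (c2.mul continuous_ofReal.continuousOn))))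
    (by
      refine ae_of_all _ fun r hr v hv' => ?_
      have hr' : r ∈ Icc (0 : ℝ) 1 := Ioc_subset_Icc_self (huI ▸ hr)
      have hm := hmem r hr' v hv'
      have hvn : ‖v‖ ≤ ‖v₀‖ + δ := by
        have := norm_add_le v₀ (v - v₀)
        rw [add_sub_cancel] at this
        linarith [mem_ball_iff_norm.1 hv']
      refine (norm_add_le _ _).trans (add_le_add (hM _ hm) ?_)
      rw [norm_mul, norm_mul, norm_real, Real.norm_eq_abs, abs_of_nonneg hr'.1]
      have h1 : ‖deriv g (r * v)‖ * r ≤ M' := by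
        nlinarith [hM' _ hm, norm_nonneg (deriv g (r * v)), hr'.1, hr'.2]
      exact mul_le_mul hvn h1 (mul_nonneg (norm_nonneg _) hr'.1) (by positivity))
    (by simp)
    (by
      refine ae_of_all _ fun r hr v hv' => ?_
      have hr' : r ∈ Icc (0 : ℝ) 1 := Ioc_subset_Icc_self (huI ▸ hr)
      have hm := hδU (hmem r hr' v hv')
      have h1 : HasDerivAt g (deriv g (r * v)) (r * v) :=
        (hg.differentiableAt (hU.mem_nhds hm)).hasDerivAt
      have h2 : HasDerivAt (fun v : ℂ => (r : ℂ) * v) r v := by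
        simpa using (hasDerivAt_id v).const_mul (r : ℂ)
      have h3 := (hasDerivAt_id v).mul (h1.comp v h2)
      simpa using! h3)
  -- The differentiated integrand is the total derivative of `r * g (r * v₀)`.
  have hval : ∫ r in (0 : ℝ)..1, (g (r * v₀) + v₀ * (deriv g (r * v₀) * r)) = g v₀ := by
    have := intervalIntegral.integral_eq_sub_of_hasDerivAt (a := (0 : ℝ)) (b := 1)
      (f := fun r : ℝ => (r : ℂ) * g (r * v₀))
      (f' := fun r : ℝ => g (r * v₀) + v₀ * (deriv g (r * v₀) * r)) ?_ main.1
    · simpa using this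
    · intro r hr
      rw [uIcc_of_le zero_le_one] at hr
      have h1 : HasDerivAt g (deriv g (r * v₀)) (r * v₀) :=
        (hg.differentiableAt (hU.mem_nhds (hv r hr))).hasDerivAt
      have h0 : HasDerivAt (fun r : ℝ => (r : ℂ)) 1 r := ofRealCLM.hasDerivAt
      have h2 : HasDerivAt (fun r : ℝ => (r : ℂ) * v₀) v₀ r := by simpa using h0.mul_const v₀
      have h3 := h0.mul (h1.comp (𝕜 := ℝ) r h2)
      refine h3.congr_deriv ?_
      rw [one_mul, Function.comp_apply]
      ring
  rw [hval] at main
  exact main.2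

/-! ### The principal square root, including its behaviour on the cut -/

namespace Complex

theorem sqrt_sq (z : ℂ) : sqrt z ^ 2 = z := by
  simp [sqrt]

theorem sqrt_re_nonneg (z : ℂ) : 0 ≤ (sqrt z).re := by
  rw [sqrt, cpow_inv_two_re]; positivity

theorem sqrt_sq_of_re_pos {z : ℂ} (hz : 0 < z.re) : sqrt (z ^ 2) = z :=
  sq_cpow_two_inv hz

theorem two_mul_sqrt_re_mul_im (z : ℂ) : 2 * ((sqrt z).re * (sqrt z).im) = z.im := by
  conv_rhs => rw [← sqrt_sq z]
  simp [sq]; ring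

theorem sqrt_re_sq_sub_im_sq (z : ℂ) : (sqrt z).re ^ 2 - (sqrt z).im ^ 2 = z.re := by
  conv_rhs => rw [← sqrt_sq z]
  simp [sq]

theorem sqrt_re_pos {z : ℂ} (hz : z ∈ slitPlane) : 0 < (sqrt z).re := by
  refine lt_of_le_of_ne (sqrt_re_nonneg z) fun h => ?_
  have h1 := two_mul_sqrt_re_mul_im z
  have h2 := sqrt_re_sq_sub_im_sq z
  rw [← h] at h1 h2
  rcases mem_slitPlane_iff.1 hz with h3 | h3
  · nlinarith [sq_nonneg (sqrt z).im]
  · exact h3 (by linarith)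

theorem sqrt_im_neg {z : ℂ} (hz : z.im < 0) : (sqrt z).im < 0 := by
  have h1 := two_mul_sqrt_re_mul_im z
  nlinarith [sqrt_re_pos (z := z) (mem_slitPlane_iff.2 (.inr hz.ne))]

theorem sqrt_im_pos {z : ℂ} (hz : 0 < z.im) : 0 < (sqrt z).im := by
  have h1 := two_mul_sqrt_re_mul_im z
  nlinarith [sqrt_re_pos (z := z) (mem_slitPlane_iff.2 (.inr hz.ne'))]

/-- Positive real part singles out the principal one among the two roots of `a * b`. -/
theorem sqrt_mul_of_re_pos {a b : ℂ} (h : 0 < (sqrt a * sqrt b).re) :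
    sqrt (a * b) = sqrt a * sqrt b := by
  conv_lhs => rw [← sqrt_sq a, ← sqrt_sq b, ← mul_pow]
  exact sqrt_sq_of_re_pos h

theorem sqrt_ne_zero {z : ℂ} (hz : z ≠ 0) : sqrt z ≠ 0 := fun h => hz (by
  rw [← sqrt_sq z, h]; simp)

theorem sqrt_ofReal (r : ℝ) : sqrt (r : ℂ) = √r + √(-r) * I := by
  rw [sqrt_eq_real_add_ite]
  rcases le_total 0 r with h | h
  · simp [abs_of_nonneg h, Real.sqrt_eq_zero_of_nonpos (neg_nonpos.2 h)]
  · simp [abs_of_nonpos h, Real.sqrt_eq_zero_of_nonpos h]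
    rw [← ofReal_div, ← Real.sqrt_div' _ zero_le_two]
    congr 2
    ring

theorem sqrt_conj {z : ℂ} (hz : z ∈ slitPlane) : sqrt (conj z) = conj (sqrt z) := by
  have h := sqrt_sq_of_re_pos (z := conj (sqrt z)) (by simpa using sqrt_re_pos hz)
  rwa [← map_pow, sqrt_sq] at h

theorem hasDerivAt_sqrt' {z : ℂ} (hz : z ∈ slitPlane) :
    HasDerivAt sqrt (1 / (2 * sqrt z)) z := by
  convert hasDerivAt_sqrt hz using 1
  rw [neg_div, cpow_neg, one_div (2 : ℂ), sqrt]
  field_simp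

end Complex

namespace Complex

/-- The principal root jumps across the negative axis but is continuous along the real line. This
covers real `x > 1`, where `1 - s * x` runs through `0` and along the cut. -/
theorem continuous_sqrt_ofReal : Continuous fun r : ℝ => sqrt (r : ℂ) := by
  simp only [sqrt_ofReal]
  fun_prop

theorem hasDerivAt_sqrt_ofReal {r : ℝ} (hr : r ≠ 0) :
    HasDerivAt (fun r : ℝ => sqrt (r : ℂ)) (1 / (2 * sqrt (r : ℂ))) r := by
  rcases hr.lt_or_gt with h | h
  · have h1 : HasDerivAt (fun s : ℝ => √(-s)) (-1 / (2 * √(-r))) r :=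
      (hasDerivAt_id r).neg.sqrt (by simpa using hr)
    have h2 := h1.ofReal_comp.mul_const I
    have hne : (√(-r) : ℂ) ≠ 0 := by
      simpa using (Real.sqrt_pos.2 (neg_pos.2 h)).ne'
    have hEq : (fun s : ℝ => sqrt (s : ℂ)) =ᶠ[𝓝 r] fun s : ℝ => (√(-s) : ℂ) * I := by
      filter_upwards [Iio_mem_nhds h] with s hs
      rw [sqrt_ofReal, Real.sqrt_eq_zero_of_nonpos (le_of_lt hs)]
      simp
    refine (h2.congr_of_eventuallyEq hEq).congr_deriv ?_
    rw [sqrt_ofReal, Real.sqrt_eq_zero_of_nonpos h.le]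
    push_cast
    field_simp
    linear_combination -(√(-r) : ℂ) * I_sq
  · simpa using HasDerivAt.comp_ofReal (hasDerivAt_sqrt' (z := r) (by simpa using h))

/-- For non-real `x` the roots of `1 - x` and `1 + x` have imaginary parts of opposite sign and
nonnegative real parts, so their product has positive real part. For real `x` the factor `1 + x` is
positive. -/
theorem sqrt_one_sub_sq {x : ℂ} (hx : -1 < x.re) :
    sqrt (1 - x ^ 2) = sqrt (1 - x) * sqrt (1 + x) := by
  rw [show 1 - x ^ 2 = (1 - x) * (1 + x) by ring]
  have h1 : 0 < (sqrt (1 + x)).re :=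
    sqrt_re_pos (mem_slitPlane_iff.2 (.inl (by simp; linarith)))
  rcases lt_trichotomy x.im 0 with h | h | h
  · refine sqrt_mul_of_re_pos ?_
    have h2 : 0 < (sqrt (1 - x)).im := sqrt_im_pos (by simpa using h)
    have h3 : (sqrt (1 + x)).im < 0 := sqrt_im_neg (by simpa using h)
    rw [mul_re]
    nlinarith [sqrt_re_nonneg (1 - x)]
  · obtain ⟨r, rfl⟩ : ∃ r : ℝ, x = r := ⟨x.re, by apply Complex.ext <;> simp [h]⟩
    simp only [ofReal_re] at hx
    rw [show (1 : ℂ) - r = ((1 - r : ℝ) : ℂ) by push_cast; rfl,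
      show (1 : ℂ) + r = ((1 + r : ℝ) : ℂ) by push_cast; rfl, ← ofReal_mul]
    simp only [sqrt_ofReal]
    rw [Real.sqrt_eq_zero_of_nonpos (x := -(1 + r)) (by linarith), ← neg_mul,
      Real.sqrt_mul' _ (by linarith), Real.sqrt_mul' _ (by linarith)]
    push_cast
    ring
  · refine sqrt_mul_of_re_pos ?_
    have h2 : (sqrt (1 - x)).im < 0 := sqrt_im_neg (by simpa using h)
    have h3 : 0 < (sqrt (1 + x)).im := sqrt_im_pos (by simpa using h)
    rw [mul_re]
    nlinarith [sqrt_re_nonneg (1 - x)]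

theorem one_sub_smul_mem_slitPlane {x : ℂ} (hx : x.im ≠ 0) (s : ℝ) :
    1 - s * x ∈ slitPlane := by
  rw [mem_slitPlane_iff]
  rcases eq_or_ne s 0 with rfl | hs
  · simp
  · right; simp [hs, hx]

theorem continuous_sqrt_one_sub (x : ℂ) : Continuous fun s : ℝ => sqrt (1 - s * x) := by
  by_cases hx : x.im = 0
  · obtain ⟨r, rfl⟩ : ∃ r : ℝ, x = r := ⟨x.re, by apply Complex.ext <;> simp [hx]⟩
    have := continuous_sqrt_ofReal.comp (show Continuous fun s : ℝ => 1 - s * r by fun_prop)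
    simpa [Function.comp_def] using this
  · exact continuous_iff_continuousAt.2 fun s =>
      ((differentiableAt_sqrt (one_sub_smul_mem_slitPlane hx s)).continuousAt).comp
        (f := fun s : ℝ => 1 - (s : ℂ) * x) (by fun_prop)

theorem hasDerivAt_sqrt_one_sub {x : ℂ} {s : ℝ} (hs : 1 - s * x ≠ 0) :
    HasDerivAt (fun s : ℝ => sqrt (1 - s * x)) (-x / (2 * sqrt (1 - s * x))) s := by
  by_cases hx : x.im = 0
  · obtain ⟨r, rfl⟩ : ∃ r : ℝ, x = r := ⟨x.re, by apply Complex.ext <;> simp [hx]⟩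
    have h0 : HasDerivAt (fun s : ℝ => 1 - s * r) (-r) s := by
      simpa using ((hasDerivAt_id s).mul_const r).const_sub 1
    have h1 : 1 - s * r ≠ 0 := by exact_mod_cast hs
    have := (hasDerivAt_sqrt_ofReal h1).scomp s h0
    simp only [Function.comp_def, ofReal_sub, ofReal_one, ofReal_mul, real_smul, ofReal_neg] at this
    refine this.congr_deriv ?_
    ring
  · have h0 : HasDerivAt (fun s : ℝ => 1 - (s : ℂ) * x) (-x) s := by
      have : HasDerivAt (fun r : ℝ => (r : ℂ)) 1 s := ofRealCLM.hasDerivAt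
      simpa using (this.mul_const x).const_sub 1
    have := (hasDerivAt_sqrt' (one_sub_smul_mem_slitPlane hx s)).comp s h0
    refine this.congr_deriv ?_
    ring

/-- For real `x ≠ 0` this is an affine change of variable in the integrable power `s ^ (-1/2)`; for
non-real `x` there is no singularity. -/
theorem intervalIntegrable_inv_sqrt_one_sub (x : ℂ) :
    IntervalIntegrable (fun s : ℝ => (sqrt (1 - s * x))⁻¹) volume 0 1 := by
  by_cases hx : x.im = 0
  · obtain ⟨r, rfl⟩ : ∃ r : ℝ, x = r := ⟨x.re, by apply Complex.ext <;> simp [hx]⟩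
    rcases eq_or_ne r 0 with rfl | hr
    · simp
    have h0 : IntervalIntegrable (fun s : ℝ => (s : ℂ) ^ (-2⁻¹ : ℂ)) volume (1 - 0) (1 - r) :=
      intervalIntegral.intervalIntegrable_cpow' (by norm_num)
    have h1 := (h0.comp_sub_left 1).comp_mul_left (c := r)
    simp only [sub_sub_cancel, zero_div, div_self hr] at h1
    refine h1.congr fun s _ => ?_
    simp only [sqrt, cpow_neg]
    push_cast
    rw [mul_comm]
  · refine ((continuous_sqrt_one_sub x).inv₀ fun s => ?_).intervalIntegrable _ _
    exact sqrt_ne_zero (slitPlane_ne_zero (one_sub_smul_mem_slitPlane hx s))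

end Complex

/-! ### Uniformizing the branch point at `1` by `x = 1 - v²` -/

/-- The part of the disc of radius `1 / t` to the right of the line `re y = -1`. -/
def ellipticDomain (t : ℝ) : Set ℂ := {y | -1 < y.re ∧ ‖y‖ < 1 / t}

/-- The factor of `√((1 - y²)(1 - t²y²))` that is regular at `y = 1`. -/
def regularFactor (t : ℝ) (y : ℂ) : ℂ := sqrt (1 + y) * sqrt (1 - t ^ 2 * y ^ 2)

/-- The incomplete elliptic integral from `1 - v²` to `1`, as a function of `v`. -/
def coEllipticK (t : ℝ) (v : ℂ) : ℂ :=
  ∫ r in (0 : ℝ)..1, v * (2 / regularFactor t (1 - (r * v) ^ 2))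

section
variable {t : ℝ}

theorem isOpen_ellipticDomain : IsOpen (ellipticDomain t) :=
  (isOpen_lt continuous_const continuous_re).inter (isOpen_lt continuous_norm continuous_const)

theorem convex_ellipticDomain : Convex ℝ (ellipticDomain t) := by
  have h : ellipticDomain t = {y : ℂ | -1 < y.re} ∩ Metric.ball 0 (1 / t) := by
    ext y; simp [ellipticDomain]
  rw [h]
  exact (convex_halfSpace_re_gt (-1)).inter (convex_ball _ _)

theorem one_mem_ellipticDomain (ht0 : 0 < t) (ht1 : t < 1) : (1 : ℂ) ∈ ellipticDomain t :=
  ⟨by simp, by rw [norm_one]; exact (one_lt_div ht0).2 ht1⟩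

theorem zero_mem_ellipticDomain (ht0 : 0 < t) : (0 : ℂ) ∈ ellipticDomain t :=
  ⟨by simp, by simpa using ht0⟩

theorem smul_mem_ellipticDomain (ht0 : 0 < t) {y : ℂ} (hy : y ∈ ellipticDomain t) {s : ℝ}
    (hs : s ∈ Icc (0 : ℝ) 1) : (s : ℂ) * y ∈ ellipticDomain t := by
  have := convex_ellipticDomain hy (zero_mem_ellipticDomain ht0) hs.1 (sub_nonneg.2 hs.2)
    (by ring)
  simpa using this

theorem conj_mem_ellipticDomain {y : ℂ} (hy : y ∈ ellipticDomain t) :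
    conj y ∈ ellipticDomain t := by
  simpa [ellipticDomain] using hy

theorem norm_sq_mul_sq_lt_one (ht0 : 0 < t) {y : ℂ} (hy : ‖y‖ < 1 / t) :
    ‖(t : ℂ) ^ 2 * y ^ 2‖ < 1 := by
  rw [← mul_pow, norm_pow, norm_mul, norm_real, Real.norm_eq_abs, abs_of_pos ht0]
  have : t * ‖y‖ < 1 := by rwa [lt_div_iff₀' ht0] at hy
  exact pow_lt_one₀ (by positivity) this two_ne_zero

theorem one_sub_mem_slitPlane (ht0 : 0 < t) {y : ℂ} (hy : ‖y‖ < 1 / t) :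
    1 - (t : ℂ) ^ 2 * y ^ 2 ∈ slitPlane := by
  refine mem_slitPlane_iff.2 (.inl ?_)
  have h := norm_sq_mul_sq_lt_one ht0 hy
  have := (re_le_norm ((t : ℂ) ^ 2 * y ^ 2))
  rw [sub_re, one_re]
  linarith

theorem one_add_mem_slitPlane {y : ℂ} (hy : y ∈ ellipticDomain t) : 1 + y ∈ slitPlane :=
  mem_slitPlane_iff.2 (.inl (by rw [add_re, one_re]; linarith [hy.1]))

theorem regularFactor_ne_zero (ht0 : 0 < t) {y : ℂ} (hy : y ∈ ellipticDomain t) :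
    regularFactor t y ≠ 0 :=
  mul_ne_zero (sqrt_ne_zero (slitPlane_ne_zero (one_add_mem_slitPlane hy)))
    (sqrt_ne_zero (slitPlane_ne_zero (one_sub_mem_slitPlane ht0 hy.2)))

theorem differentiableOn_regularFactor (ht0 : 0 < t) :
    DifferentiableOn ℂ (regularFactor t) (ellipticDomain t) := by
  intro y hy
  refine (DifferentiableAt.mul ?_ ?_).differentiableWithinAt
  · exact (differentiableAt_sqrt (one_add_mem_slitPlane hy)).comp y (by fun_prop)
  · exact (differentiableAt_sqrt (one_sub_mem_slitPlane ht0 hy.2)).comp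
      (f := fun y => 1 - (t : ℂ) ^ 2 * y ^ 2) y (by fun_prop)

theorem one_sub_smul_sq_mem (ht0 : 0 < t) (ht1 : t < 1) {v : ℂ}
    (hv : 1 - v ^ 2 ∈ ellipticDomain t) {r : ℝ} (hr : r ∈ Icc (0 : ℝ) 1) :
    1 - ((r : ℂ) * v) ^ 2 ∈ ellipticDomain t := by
  have h2 : r ^ 2 ≤ 1 := by nlinarith [hr.1, hr.2]
  have := convex_ellipticDomain hv (one_mem_ellipticDomain ht0 ht1) (sq_nonneg r)
    (sub_nonneg.2 h2) (by ring)
  convert this using 1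
  simp only [real_smul]
  push_cast
  ring

/-- Under `x = 1 - v²` the factor `√(1 - x)` becomes `v` and cancels against `dx = -2v dv`, so
nothing singular is left at `v = 0`. -/
theorem hasDerivAt_coEllipticK (ht0 : 0 < t) (ht1 : t < 1) {v : ℂ}
    (hv : 1 - v ^ 2 ∈ ellipticDomain t) :
    HasDerivAt (coEllipticK t) (2 / regularFactor t (1 - v ^ 2)) v := by
  have hU : IsOpen ((fun v : ℂ => 1 - v ^ 2) ⁻¹' ellipticDomain t) :=
    isOpen_ellipticDomain.preimage (by fun_prop)
  refine hasDerivAt_integral_segment (g := fun v => 2 / regularFactor t (1 - v ^ 2)) hU ?_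
    fun r hr => one_sub_smul_sq_mem ht0 ht1 hv hr
  intro w hw
  have h1 : DifferentiableAt ℂ (regularFactor t) (1 - w ^ 2) :=
    (differentiableOn_regularFactor ht0).differentiableAt (isOpen_ellipticDomain.mem_nhds hw)
  have h2 : DifferentiableAt ℂ (fun w : ℂ => regularFactor t (1 - w ^ 2)) w :=
    h1.comp (f := fun w : ℂ => 1 - w ^ 2) w (by fun_prop)
  exact ((differentiableAt_const 2).div h2 (regularFactor_ne_zero ht0 hw)).differentiableWithinAt

theorem coEllipticK_neg (v : ℂ) : coEllipticK t (-v) = -coEllipticK t v := by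
  simp [coEllipticK]

theorem coEllipticK_zero : coEllipticK t 0 = 0 := by
  simp [coEllipticK]

theorem regularFactor_conj (ht0 : 0 < t) {y : ℂ} (hy : y ∈ ellipticDomain t) :
    regularFactor t (conj y) = conj (regularFactor t y) := by
  rw [regularFactor, regularFactor, map_mul, ← sqrt_conj (one_add_mem_slitPlane hy),
    ← sqrt_conj (one_sub_mem_slitPlane ht0 hy.2)]
  simp

theorem coEllipticK_conj (ht0 : 0 < t) (ht1 : t < 1) {v : ℂ}
    (hv : 1 - v ^ 2 ∈ ellipticDomain t) : coEllipticK t (conj v) = conj (coEllipticK t v) := by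
  rw [coEllipticK, coEllipticK, intervalIntegral.intervalIntegral_eq_integral_uIoc,
    intervalIntegral.intervalIntegral_eq_integral_uIoc, if_pos zero_le_one, one_smul, one_smul,
    ← integral_conj, uIoc_of_le zero_le_one]
  refine setIntegral_congr_fun measurableSet_Ioc fun r hr => ?_
  have h := regularFactor_conj ht0 (one_sub_smul_sq_mem ht0 ht1 hv (Ioc_subset_Icc_self hr))
  simp only [map_sub, map_one, map_pow, map_mul, conj_ofReal] at h
  have h2 : conj (2 : ℂ) = 2 := Complex.conj_ofNat 2
  simp [h, h2]

/-- The function `-coEllipticK t (sqrt (1 - s * x))` is a continuous primitive of the integrand,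
differentiable except where `s * x = 1`. That is at most one `s`, so the fundamental theorem with a
countable exceptional set applies. -/
theorem ellipticK_eq_sub (ht0 : 0 < t) (ht1 : t < 1) {x : ℂ} (hx : x ∈ ellipticDomain t) :
    ellipticK x t = coEllipticK t 1 - coEllipticK t (sqrt (1 - x)) := by
  have hmem : ∀ s ∈ Icc (0 : ℝ) 1, (s : ℂ) * x ∈ ellipticDomain t :=
    fun s hs => smul_mem_ellipticDomain ht0 hx hs
  have hint : ∀ s ∈ Icc (0 : ℝ) 1,
      x / ((1 - ((s : ℂ) * x) ^ 2) ^ (1 / 2 : ℂ) *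
        (1 - (t : ℂ) ^ 2 * ((s : ℂ) * x) ^ 2) ^ (1 / 2 : ℂ))
      = (sqrt (1 - s * x))⁻¹ * (x / regularFactor t (s * x)) := by
    intro s hs
    have h := sqrt_one_sub_sq (hmem s hs).1
    rw [one_div (2 : ℂ), ← sqrt, ← sqrt, h, regularFactor]
    field_simp
  have hInt : IntervalIntegrable (fun s : ℝ => (sqrt (1 - s * x))⁻¹ *
      (x / regularFactor t (s * x))) volume 0 1 := by
    refine (intervalIntegrable_inv_sqrt_one_sub x).mul_continuousOn ?_
    rw [uIcc_of_le zero_le_one]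
    refine continuousOn_const.div ?_ fun s hs => regularFactor_ne_zero ht0 (hmem s hs)
    exact (differentiableOn_regularFactor ht0).continuousOn.comp (by fun_prop) hmem
  have hsub : ∀ s : ℝ, 1 - sqrt (1 - s * x) ^ 2 = s * x := fun s => by rw [sqrt_sq]; ring
  have hderiv : ∀ s ∈ Icc (0 : ℝ) 1, HasDerivAt (coEllipticK t)
      (2 / regularFactor t (s * x)) (sqrt (1 - s * x)) := by
    intro s hs
    have := hasDerivAt_coEllipticK ht0 ht1 (v := sqrt (1 - s * x))
      (by rw [hsub]; exact hmem s hs)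
    rwa [hsub] at this
  have hcount : ({s : ℝ | 1 - (s : ℂ) * x = 0}).Countable := by
    refine Set.Subsingleton.countable fun a ha b hb => ?_
    simp only [mem_ofPred_eq, sub_eq_zero] at ha hb
    have hx0 : x ≠ 0 := by rintro rfl; simp at ha
    exact_mod_cast mul_right_cancel₀ hx0 (ha.symm.trans hb)
  have := MeasureTheory.integral_eq_of_hasDerivAt_off_countable_of_le
    (fun s : ℝ => -coEllipticK t (sqrt (1 - s * x)))
    (fun s : ℝ => (sqrt (1 - s * x))⁻¹ * (x / regularFactor t (s * x))) zero_le_one hcount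
    (by
      refine ContinuousOn.neg fun s hs => ?_
      exact ((hderiv s hs).continuousAt.comp (f := fun s : ℝ => sqrt (1 - s * x))
        (continuous_sqrt_one_sub x).continuousAt).continuousWithinAt)
    (by
      rintro s ⟨hs, hs'⟩
      have h1 := ((hderiv s (Ioo_subset_Icc_self hs)).comp s (hasDerivAt_sqrt_one_sub hs')).neg
      refine h1.congr_deriv ?_
      have := regularFactor_ne_zero ht0 (hmem s (Ioo_subset_Icc_self hs))
      have := sqrt_ne_zero hs'
      field_simp) hInt
  rw [ellipticK, intervalIntegral.integral_congr (fun s hs => hint s (by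
    rwa [uIcc_of_le zero_le_one] at hs)), this]
  simp
  ring

theorem coEllipticK_one (ht0 : 0 < t) (ht1 : t < 1) :
    coEllipticK t 1 = completeEllipticK t := by
  rw [← ellipticK_one ht0 ht1, ellipticK_eq_sub ht0 ht1 (one_mem_ellipticDomain ht0 ht1)]
  simp [coEllipticK_zero]

end

/-! ### The bound `Re K(x,t) < K(1,t)` via positivity of `Re coEllipticK` -/

theorem lt_of_hasDerivAt_pos {f f' : ℝ → ℝ} {a b : ℝ} (hab : a < b)
    (hc : ContinuousOn f (Icc a b)) (hd : ∀ s ∈ Ioo a b, HasDerivAt f (f' s) s)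
    (hp : ∀ s ∈ Ioo a b, 0 < f' s) : f a < f b := by
  refine strictMonoOn_of_deriv_pos (convex_Icc a b) hc (fun s hs => ?_)
    (left_mem_Icc.2 hab.le) (right_mem_Icc.2 hab.le) hab
  rw [interior_Icc] at hs
  rw [(hd s hs).deriv]
  exact hp s hs

/-- Let `arg w = -α` and `arg s = β` with `α, β ∈ [0, π/2)`. When both angles are positive,
cancellation of the imaginary parts gives `Re (w² + s²)` the sign of `sin (2α + 2β)`, which forces
`α + β < π/2`; the other cases are immediate. -/
theorem re_mul_conj_pos {w s : ℂ} (hw : 0 < w.re) (hwi : w.im ≤ 0) (hs : 0 < s.re)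
    (hsi : 0 ≤ s.im) (h : 0 < (w ^ 2 + s ^ 2).re) (hi : (w ^ 2 + s ^ 2).im = 0) :
    0 < (w * conj s).re := by
  simp only [sq, add_re, mul_re, add_im, mul_im, conj_re, conj_im] at h hi ⊢
  obtain ⟨A, B⟩ := w
  obtain ⟨C, D⟩ := s
  simp only at *
  by_contra hcon
  have h1 : A * B + C * D = 0 := by linarith
  have h2 : A * C ≤ -B * D := by linarith
  have hAC : 0 < A * C := mul_pos hw hs
  have hB : 0 < -B := lt_of_le_of_ne (by linarith) fun h0 => by
    rw [← h0] at h2; linarith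
  have hD : 0 < D := lt_of_le_of_ne hsi fun h0 => by
    rw [← h0] at h2; linarith
  -- From `A(-B) = CD` and `AC ≤ -BD` follow `A ≤ D` and `C ≤ -B`, contradicting `A² + C² > B² +
  -- D²`.
  have h3 : A ≤ D := by
    by_contra h4
    have h5 : C < -B := by
      by_contra h6
      nlinarith
    nlinarith
  have h4 : C ≤ -B := by
    by_contra h4
    nlinarith
  nlinarith

section
variable {t : ℝ}

theorem re_div_regularFactor_pos (ht0 : 0 < t) {w y : ℂ} (hw : 0 < w.re) (hwi : w.im ≤ 0)
    (hy : y ∈ ellipticDomain t) (hyr : 0 ≤ y.re) (hyi : 0 ≤ y.im)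
    (hwy : ∃ r : ℝ, 0 < r ∧ 1 - y = (r * w) ^ 2) : 0 < (w * (2 / regularFactor t y)).re := by
  obtain ⟨r, hr, hwy⟩ := hwy
  rw [regularFactor]
  set s := sqrt (1 + y) with hs
  set q := sqrt (1 - (t : ℂ) ^ 2 * y ^ 2) with hq
  have hs2 : s ^ 2 = 1 + y := sqrt_sq _
  have hsr : 0 < s.re := sqrt_re_pos (one_add_mem_slitPlane hy)
  have hqr : 0 < q.re := sqrt_re_pos (one_sub_mem_slitPlane ht0 hy.2)
  have hsi : 0 ≤ s.im := by
    have := two_mul_sqrt_re_mul_im (1 + y)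
    rw [← hs, add_im, one_im, zero_add] at this
    nlinarith
  have hqi : q.im ≤ 0 := by
    have := two_mul_sqrt_re_mul_im (1 - (t : ℂ) ^ 2 * y ^ 2)
    rw [← hq, ← mul_pow] at this
    simp [sq] at this
    have h3 : 0 ≤ t * y.re * (t * y.im) := by positivity
    nlinarith
  -- Here `(r w)² + s² = (1 - y) + (1 + y) = 2`, a positive real number.
  have h1 : 0 < ((r * w) * conj s).re := by
    refine re_mul_conj_pos (by simpa using mul_pos hr hw) ?_ hsr hsi ?_ ?_
    · simpa using mul_nonpos_of_nonneg_of_nonpos hr.le hwi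
    all_goals rw [← hwy, hs2]; simp
  have h1' : 0 < (w * conj s).re := by
    rw [mul_assoc, re_ofReal_mul] at h1
    exact pos_of_mul_pos_right h1 hr.le
  have h2 : (w * conj s).im ≤ 0 := by
    rw [mul_im, conj_re, conj_im]
    nlinarith
  have h3 : 0 < (w * conj s * conj q).re := by
    rw [mul_re, conj_re, conj_im]
    nlinarith
  have hs0 : s ≠ 0 := fun h => by simp [h] at hsr
  have hq0 : q ≠ 0 := fun h => by simp [h] at hqr
  have h4 : w * (2 / (s * q)) = ((2 / (normSq s * normSq q) : ℝ) : ℂ) * (w * conj s * conj q) := by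
    push_cast
    rw [normSq_eq_conj_mul_self, normSq_eq_conj_mul_self]
    have : conj s ≠ 0 := by simpa using hs0
    have : conj q ≠ 0 := by simpa using hq0
    field_simp
  rw [h4, re_ofReal_mul]
  exact mul_pos (div_pos two_pos (mul_pos (normSq_pos.2 hs0) (normSq_pos.2 hq0))) h3

theorem re_coEllipticK_pos (ht0 : 0 < t) (ht1 : t < 1) {v : ℂ} (hv : 0 < v.re) (hvi : v.im ≤ 0)
    (hvd : 1 - v ^ 2 ∈ ellipticDomain t) (hvr : 0 ≤ (1 - v ^ 2).re) :
    0 < (coEllipticK t v).re := by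
  have hd : ∀ r ∈ Icc (0 : ℝ) 1, HasDerivAt (fun r : ℝ => (coEllipticK t (r * v)).re)
      (v * (2 / regularFactor t (1 - (r * v) ^ 2))).re r := by
    intro r hr
    have h1 := hasDerivAt_coEllipticK ht0 ht1 (one_sub_smul_sq_mem ht0 ht1 hvd hr)
    have h0 : HasDerivAt (fun r : ℝ => (r : ℂ) * v) v r := by
      have : HasDerivAt (fun r : ℝ => (r : ℂ)) 1 r := ofRealCLM.hasDerivAt
      simpa using this.mul_const v
    have h2 := reCLM.hasFDerivAt.comp_hasDerivAt r (h1.comp r h0)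
    refine h2.congr_deriv ?_
    simp [mul_comm]
  have := lt_of_hasDerivAt_pos zero_lt_one
    (fun r hr => (hd r hr).continuousAt.continuousWithinAt)
    (fun r hr => hd r (Ioo_subset_Icc_self hr)) (fun r hr => ?_)
  · simpa [coEllipticK_zero] using this
  · refine re_div_regularFactor_pos ht0 hv hvi
      (one_sub_smul_sq_mem ht0 ht1 hvd (Ioo_subset_Icc_self hr)) ?_ ?_ ⟨r, hr.1, by ring⟩
    · have : r ^ 2 ≤ 1 := by nlinarith [hr.1, hr.2]
      simp only [mul_pow, ← ofReal_pow, sub_re, one_re, re_ofReal_mul] at hvr ⊢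
      nlinarith [sq_nonneg r]
    · simp only [mul_pow, ← ofReal_pow, sub_im, one_im, sq v, mul_im, ofReal_re, ofReal_im]
      have := mul_nonneg (sq_nonneg r) (mul_nonneg hv.le (neg_nonneg.2 hvi))
      linarith

theorem completeEllipticK_pos (ht0 : 0 < t) (ht1 : t < 1) : 0 < completeEllipticK t := by
  have := re_coEllipticK_pos (v := 1) ht0 ht1 (by simp) (by simp)
    (by simpa using zero_mem_ellipticDomain ht0) (by simp)
  rwa [coEllipticK_one ht0 ht1, ofReal_re] at this

/-! ### Analytic continuation of `sin (c K)` to the disc `|x| < 1/t` -/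

/-- The function `sin (π / (2 K(1,t)) · K(x,t))`. -/
def sinEllipticK (t : ℝ) (x : ℂ) : ℂ :=
  Complex.sin ((π : ℂ) / (2 * ellipticK 1 t) * ellipticK x t)

theorem ellipseMap_eq (z : ℂ) : ellipseMap t z = sinEllipticK t (z / (√t : ℝ)) := rfl

theorem ellipticK_neg (x : ℂ) : ellipticK (-x) t = -ellipticK x t := by
  simp [ellipticK, neg_div]

theorem sinEllipticK_neg (x : ℂ) : sinEllipticK t (-x) = -sinEllipticK t x := by
  simp [sinEllipticK, ellipticK_neg]

theorem sinEllipticK_eq_sin (ht0 : 0 < t) (ht1 : t < 1) (x : ℂ) :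
    sinEllipticK t x = Complex.sin ((π / (2 * completeEllipticK t) : ℝ) * ellipticK x t) := by
  rw [sinEllipticK, ellipticK_one ht0 ht1]
  push_cast
  rfl

/-- Since `c K(1) = π/2`, the sine turns into a cosine. Evenness of `cos` and oddness of
`coEllipticK` make the choice of root `v` irrelevant, and with it the cut of `√(1 - x)`. -/
theorem sinEllipticK_eq_cos (ht0 : 0 < t) (ht1 : t < 1) {x v : ℂ} (hx : x ∈ ellipticDomain t)
    (hv : v ^ 2 = 1 - x) :
    sinEllipticK t x
      = Complex.cos ((π / (2 * completeEllipticK t) : ℝ) * coEllipticK t v) := by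
  have hK : (completeEllipticK t : ℂ) ≠ 0 := by exact_mod_cast (completeEllipticK_pos ht0 ht1).ne'
  have h1 : sinEllipticK t x = Complex.cos ((π / (2 * completeEllipticK t) : ℝ) *
      coEllipticK t (sqrt (1 - x))) := by
    rw [sinEllipticK_eq_sin ht0 ht1, ellipticK_eq_sub ht0 ht1 hx, coEllipticK_one ht0 ht1, mul_sub,
      show ((π / (2 * completeEllipticK t) : ℝ) : ℂ) * completeEllipticK t = π / 2 by
        push_cast; field_simp, Complex.sin_pi_div_two_sub]
  have h2 : v = sqrt (1 - x) ∨ v = -sqrt (1 - x) := by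
    rw [← sq_eq_sq_iff_eq_or_eq_neg, hv, sqrt_sq]
  rcases h2 with h2 | h2
  · rw [h1, h2]
  · rw [h1, h2, coEllipticK_neg, mul_neg, Complex.cos_neg]

theorem differentiableAt_sinEllipticK_of_local_sqrt (ht0 : 0 < t) (ht1 : t < 1) {x₀ : ℂ}
    (hx : x₀ ∈ ellipticDomain t) {v : ℂ → ℂ} (hv : DifferentiableAt ℂ v x₀)
    (hv2 : ∀ x, v x ^ 2 = 1 - x) : DifferentiableAt ℂ (sinEllipticK t) x₀ := by
  have h1 : DifferentiableAt ℂ (coEllipticK t) (v x₀) :=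
    (hasDerivAt_coEllipticK ht0 ht1 (by rw [hv2, sub_sub_cancel]; exact hx)).differentiableAt
  have h2 : DifferentiableAt ℂ (fun x => Complex.cos ((π / (2 * completeEllipticK t) : ℝ) *
      coEllipticK t (v x))) x₀ := ((h1.comp x₀ hv).const_mul _).ccos
  refine h2.congr_of_eventuallyEq ?_
  filter_upwards [isOpen_ellipticDomain.mem_nhds hx] with x hx'
  exact sinEllipticK_eq_cos ht0 ht1 hx' (hv2 x)

theorem differentiableOn_sinEllipticK_ellipticDomain (ht0 : 0 < t) (ht1 : t < 1) :
    DifferentiableOn ℂ (sinEllipticK t) (ellipticDomain t) := by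
  refine (differentiableOn_compl_singleton_and_continuousAt_iff (c := 1)
    (isOpen_ellipticDomain.mem_nhds (one_mem_ellipticDomain ht0 ht1))).1 ⟨?_, ?_⟩
  · rintro x ⟨hx, hx1⟩
    have hw : 1 - x ≠ 0 := sub_ne_zero.2 (Ne.symm hx1)
    refine (differentiableAt_sinEllipticK_of_local_sqrt ht0 ht1 hx
      -- A branch of the root adapted to `x`: the quotient is `1` at `y = x`, hence off the cut even
      -- when `1 - x` is negative. The point `x = 1` is then a removable singularity.
      (v := fun y => sqrt (1 - x) * sqrt ((1 - y) / (1 - x))) ?_ fun y => ?_).differentiableWithinAt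
    · refine DifferentiableAt.const_mul ?_ _
      refine (differentiableAt_sqrt ?_).comp (f := fun y => (1 - y) / (1 - x)) x (by fun_prop)
      simp [div_self hw]
    · rw [mul_pow, sqrt_sq, sqrt_sq, mul_div_cancel₀ _ hw]
  · have h1 : ContinuousAt (coEllipticK t) (sqrt (1 - 1)) :=
      (hasDerivAt_coEllipticK ht0 ht1 (by simpa using one_mem_ellipticDomain ht0 ht1)).continuousAt
    have h2 : ContinuousAt (fun x : ℂ => sqrt (1 - x)) 1 :=
      ContinuousAt.comp (f := fun x : ℂ => 1 - x) (continuousAt_sqrt (by simp)) (by fun_prop)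
    have h3 : ContinuousAt (fun x => Complex.cos ((π / (2 * completeEllipticK t) : ℝ) *
        coEllipticK t (sqrt (1 - x)))) 1 :=
      Complex.continuous_cos.continuousAt.comp
        (continuousAt_const.mul (ContinuousAt.comp (f := fun x : ℂ => sqrt (1 - x)) h1 h2))
    refine h3.congr ?_
    filter_upwards [isOpen_ellipticDomain.mem_nhds (one_mem_ellipticDomain ht0 ht1)] with x hx
    exact (sinEllipticK_eq_cos ht0 ht1 hx (sqrt_sq _)).symm

theorem mem_or_neg_mem_ellipticDomain {x : ℂ} (hx : ‖x‖ < 1 / t) :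
    x ∈ ellipticDomain t ∨ -x ∈ ellipticDomain t := by
  rcases le_total 0 x.re with h | h
  · exact .inl ⟨by linarith, hx⟩
  · exact .inr ⟨by rw [neg_re]; linarith, by rwa [norm_neg]⟩

theorem differentiableOn_sinEllipticK (ht0 : 0 < t) (ht1 : t < 1) :
    DifferentiableOn ℂ (sinEllipticK t) (Metric.ball 0 (1 / t)) := by
  intro x hx
  refine DifferentiableAt.differentiableWithinAt ?_
  have key : ∀ y ∈ ellipticDomain t, DifferentiableAt ℂ (sinEllipticK t) y := fun y hy =>
    (differentiableOn_sinEllipticK_ellipticDomain ht0 ht1).differentiableAt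
      (isOpen_ellipticDomain.mem_nhds hy)
  rcases mem_or_neg_mem_ellipticDomain (by simpa using hx) with h | h
  · exact key x h
  · have h1 : DifferentiableAt ℂ (fun y => -sinEllipticK t (-y)) x :=
      ((key _ h).comp (f := fun y => -y) x (by fun_prop)).neg
    simpa [sinEllipticK_neg] using h1

theorem sinEllipticK_conj (ht0 : 0 < t) (ht1 : t < 1) {x : ℂ} (hx : ‖x‖ < 1 / t) :
    sinEllipticK t (conj x) = conj (sinEllipticK t x) := by
  have key : ∀ y ∈ ellipticDomain t,
      sinEllipticK t (conj y) = conj (sinEllipticK t y) := by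
    intro y hy
    -- The conjugate root need not be principal when `1 - y` is on the cut, but any root will do.
    rw [sinEllipticK_eq_cos ht0 ht1 (v := conj (sqrt (1 - y))) (conj_mem_ellipticDomain hy)
      (by rw [← map_pow, sqrt_sq]; simp), sinEllipticK_eq_cos ht0 ht1 hy (sqrt_sq _),
      coEllipticK_conj ht0 ht1 (by rw [sqrt_sq, sub_sub_cancel]; exact hy), ← Complex.cos_conj,
      map_mul, conj_ofReal]
  rcases mem_or_neg_mem_ellipticDomain hx with h | h
  · exact key x h
  · have := key _ h
    simpa [sinEllipticK_neg] using this

theorem hasDerivAt_ellipticK (ht0 : 0 < t) (ht1 : t < 1) {x : ℂ} (hx : x ∈ ellipticDomain t)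
    (hs : 1 - x ∈ slitPlane) :
    HasDerivAt (fun x => ellipticK x t)
      (1 / (sqrt (1 - x ^ 2) * sqrt (1 - t ^ 2 * x ^ 2))) x := by
  have h1 := hasDerivAt_coEllipticK ht0 ht1 (v := sqrt (1 - x))
    (by rw [sqrt_sq, sub_sub_cancel]; exact hx)
  rw [sqrt_sq, sub_sub_cancel] at h1
  have h2 : HasDerivAt (fun x : ℂ => 1 - x) (-1) x := by
    simpa using (hasDerivAt_id x).const_sub 1
  have h3 := (h1.comp x ((hasDerivAt_sqrt' hs).comp x h2)).const_sub (coEllipticK t 1)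
  refine (h3.congr_of_eventuallyEq ?_).congr_deriv ?_
  · filter_upwards [isOpen_ellipticDomain.mem_nhds hx] with y hy
    exact ellipticK_eq_sub ht0 ht1 hy
  · rw [sqrt_one_sub_sq hx.1, regularFactor]
    have := sqrt_ne_zero (slitPlane_ne_zero hs)
    field_simp

theorem ellipseMap_zero : ellipseMap t 0 = 0 := by
  simp [ellipseMap, ellipticK]

theorem hasDerivAt_ellipseMap_zero (ht0 : 0 < t) (ht1 : t < 1) :
    HasDerivAt (ellipseMap t) ((π / (2 * completeEllipticK t) / √t : ℝ) : ℂ) 0 := by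
  have h1 := hasDerivAt_ellipticK ht0 ht1 (zero_mem_ellipticDomain ht0) (by simp)
  have h0 : ellipticK 0 t = 0 := by simp [ellipticK]
  have h2 := (h1.const_mul (((π / (2 * completeEllipticK t) : ℝ)) : ℂ)).csin
  have h3 : HasDerivAt (sinEllipticK t) ((π / (2 * completeEllipticK t) : ℝ) : ℂ) 0 := by
    have h4 : sinEllipticK t = fun x =>
      Complex.sin ((π / (2 * completeEllipticK t) : ℝ) * ellipticK x t) :=
      funext fun x => sinEllipticK_eq_sin ht0 ht1 x
    rw [h4]
    refine h2.congr_deriv ?_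
    simp [h0]
  have h4 : HasDerivAt (fun z : ℂ => z / (√t : ℝ)) (1 / (√t : ℝ)) 0 :=
    (hasDerivAt_id (0 : ℂ)).div_const _
  have h5 := HasDerivAt.comp (0 : ℂ) (h₂ := sinEllipticK t) (by simpa using h3) h4
  refine h5.congr_deriv ?_
  push_cast
  ring

end

/-! ### The elliptic integral on the quarter disc `t|x|² ≤ 1` -/

/-- The integrand `1 / (√(1 - x²) √(1 - t²x²))` of the elliptic integral of the first kind. -/
def ellipticIntegrand (t : ℝ) (x : ℂ) : ℂ := 1 / (sqrt (1 - x ^ 2) * sqrt (1 - t ^ 2 * x ^ 2))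

section
variable {t : ℝ}

theorem norm_lt_of_mul_sq_le (ht0 : 0 < t) (ht1 : t < 1) {x : ℂ} (hx : t * ‖x‖ ^ 2 ≤ 1) :
    ‖x‖ < 1 / t := by
  rw [lt_div_iff₀ ht0]
  by_contra! h
  nlinarith [norm_nonneg x]

theorem mem_ellipticDomain_of_re_nonneg (ht0 : 0 < t) (ht1 : t < 1) {x : ℂ} (h : 0 ≤ x.re)
    (hx : t * ‖x‖ ^ 2 ≤ 1) : x ∈ ellipticDomain t :=
  ⟨by linarith, norm_lt_of_mul_sq_le ht0 ht1 hx⟩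

theorem sqrt_one_sub_sq_mem {x : ℂ} (hr : 0 < x.re) (hi : 0 < x.im) :
    0 < (sqrt (1 - x ^ 2)).re ∧ (sqrt (1 - x ^ 2)).im < 0 := by
  have h : (1 - x ^ 2).im < 0 := by
    simp only [sq, sub_im, one_im, mul_im]
    nlinarith
  exact ⟨sqrt_re_pos (mem_slitPlane_iff.2 (.inr h.ne)), sqrt_im_neg h⟩

theorem sqrt_one_sub_mul_sq_mem (ht0 : 0 < t) {x : ℂ} (hr : 0 < x.re) (hi : 0 < x.im) :
    0 < (sqrt (1 - (t : ℂ) ^ 2 * x ^ 2)).re ∧ (sqrt (1 - (t : ℂ) ^ 2 * x ^ 2)).im < 0 := by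
  rw [← mul_pow]
  exact sqrt_one_sub_sq_mem (by simpa using mul_pos ht0 hr) (by simpa using mul_pos ht0 hi)

theorem ellipticIntegrand_im_pos (ht0 : 0 < t) {x : ℂ} (hr : 0 < x.re) (hi : 0 < x.im) :
    0 < (ellipticIntegrand t x).im := by
  obtain ⟨h1, h2⟩ := sqrt_one_sub_sq_mem hr hi
  obtain ⟨h3, h4⟩ := sqrt_one_sub_mul_sq_mem ht0 hr hi
  rw [ellipticIntegrand, one_div, inv_im]
  have h : (sqrt (1 - x ^ 2) * sqrt (1 - (t : ℂ) ^ 2 * x ^ 2)).im < 0 := by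
    rw [mul_im]; nlinarith
  refine div_pos (neg_pos.2 h) (normSq_pos.2 fun h0 => ?_)
  simp [h0] at h

/-- With `p`, `q` the two roots, the quantity is `(p / x) * q`. Both factors lie in the open fourth
quadrant; for `p / x` this uses `(p / x)² = 1/x² - 1`. -/
theorem im_inv_mul_ellipticIntegrand_neg (ht0 : 0 < t) {x : ℂ} (hr : 0 < x.re) (hi : 0 < x.im) :
    ((x * ellipticIntegrand t x)⁻¹).im < 0 := by
  obtain ⟨h1, h2⟩ := sqrt_one_sub_sq_mem hr hi
  obtain ⟨h3, h4⟩ := sqrt_one_sub_mul_sq_mem ht0 hr hi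
  have hx : x ≠ 0 := fun h => by simp [h] at hr
  set p := sqrt (1 - x ^ 2) with hp
  set q := sqrt (1 - (t : ℂ) ^ 2 * x ^ 2) with hq
  have e : (x * ellipticIntegrand t x)⁻¹ = p / x * q := by
    rw [ellipticIntegrand, ← hp, ← hq, one_div, mul_inv, inv_inv]
    ring
  have hpi : (p / x).im < 0 := by
    rw [div_im, ← sub_div]
    refine div_neg_of_neg_of_pos ?_ (normSq_pos.2 hx)
    nlinarith
  have hpr : 0 < (p / x).re := by
    have h5 : ((p / x) ^ 2).im < 0 := by
      rw [div_pow, hp, sqrt_sq, sub_div, div_self (pow_ne_zero 2 hx), one_div, sub_im, one_im,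
        inv_im, sub_zero]
      refine div_neg_of_neg_of_pos ?_ (normSq_pos.2 (pow_ne_zero 2 hx))
      simp only [sq, mul_im]
      nlinarith
    rw [sq, mul_im] at h5
    nlinarith
  rw [e, mul_im]
  nlinarith

/-- Writing `x⁻²` as `conj (x²) / |x|⁴` shows that the imaginary part is `Im (x²) (t² - |x|⁻⁴)`. Its
factor `t² - |x|⁻⁴` vanishes exactly on `t|x|² = 1`, which is why that circle is special. -/
theorem inv_mul_ellipticIntegrand_sq {x : ℂ} (hx : x ≠ 0) :
    (x * ellipticIntegrand t x)⁻¹ ^ 2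
      = conj (x ^ 2) / (‖x‖ ^ 4 : ℝ) + t ^ 2 * x ^ 2 - 1 - t ^ 2 := by
  have h : (x ^ 2)⁻¹ = conj (x ^ 2) / (‖x‖ ^ 4 : ℝ) := by
    rw [Complex.inv_def, normSq_eq_norm_sq, norm_pow, ← pow_mul, div_eq_mul_inv]
    push_cast
    rfl
  rw [← h, ellipticIntegrand, inv_pow, mul_pow, one_div, inv_pow, mul_pow, sqrt_sq, sqrt_sq,
    mul_inv, inv_inv]
  field_simp
  ring

theorem im_inv_mul_ellipticIntegrand_sq {x : ℂ} (hx : x ≠ 0) :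
    ((x * ellipticIntegrand t x)⁻¹ ^ 2).im = (x ^ 2).im * (t ^ 2 - 1 / ‖x‖ ^ 4) := by
  rw [inv_mul_ellipticIntegrand_sq hx]
  simp only [add_im, sub_im, div_ofReal_im, conj_im, ← ofReal_pow, im_ofReal_mul, ofReal_im, one_im]
  ring

theorem im_mul_ellipticIntegrand_pos (ht0 : 0 < t) {x : ℂ} (hr : 0 < x.re) (hi : 0 < x.im) :
    0 < (x * ellipticIntegrand t x).im := by
  have h := im_inv_mul_ellipticIntegrand_neg ht0 hr hi
  rw [← inv_inv (x * ellipticIntegrand t x), inv_im]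
  refine div_pos (neg_pos.2 h) (normSq_pos.2 fun h0 => ?_)
  simp [h0] at h

theorem re_mul_ellipticIntegrand_pos (ht0 : 0 < t) {x : ℂ} (hr : 0 < x.re) (hi : 0 < x.im)
    (hx : t * ‖x‖ ^ 2 < 1) : 0 < (x * ellipticIntegrand t x).re := by
  have h := im_inv_mul_ellipticIntegrand_neg ht0 hr hi
  have hx0 : x ≠ 0 := fun h => by simp [h] at hr
  have h2 := im_inv_mul_ellipticIntegrand_sq (t := t) hx0
  have hn : 0 < ‖x‖ := norm_pos_iff.2 hx0
  have h3 : t ^ 2 < 1 / ‖x‖ ^ 4 := by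
    rw [lt_div_iff₀ (by positivity)]
    have : t ^ 2 * ‖x‖ ^ 4 = (t * ‖x‖ ^ 2) ^ 2 := by ring
    rw [this]
    exact pow_lt_one₀ (by positivity) hx two_ne_zero
  rw [sq, mul_im, sq x, mul_im] at h2
  have h4 := mul_pos hr hi
  rw [← inv_inv (x * ellipticIntegrand t x), inv_re]
  refine div_pos ?_ (normSq_pos.2 fun h0 => by simp [h0] at h)
  nlinarith

theorem re_mul_ellipticIntegrand_eq_zero (ht0 : 0 < t) {x : ℂ} (hr : 0 < x.re) (hi : 0 < x.im)
    (hx : t * ‖x‖ ^ 2 = 1) : (x * ellipticIntegrand t x).re = 0 := by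
  have h := im_inv_mul_ellipticIntegrand_neg ht0 hr hi
  have hx0 : x ≠ 0 := fun h => by simp [h] at hr
  have h2 := im_inv_mul_ellipticIntegrand_sq (t := t) hx0
  have hn : 0 < ‖x‖ := norm_pos_iff.2 hx0
  have h3 : t ^ 2 = 1 / ‖x‖ ^ 4 := by
    rw [eq_div_iff (by positivity)]
    have : t ^ 2 * ‖x‖ ^ 4 = (t * ‖x‖ ^ 2) ^ 2 := by ring
    rw [this, hx, one_pow]
  rw [h3, sub_self, mul_zero, sq, mul_im] at h2
  rw [← inv_inv (x * ellipticIntegrand t x), inv_re]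
  have h5 : (x * ellipticIntegrand t x)⁻¹.re = 0 := by
    have : (x * ellipticIntegrand t x)⁻¹.re * (x * ellipticIntegrand t x)⁻¹.im = 0 := by linarith
    exact (mul_eq_zero.1 this).resolve_right h.ne
  rw [h5, zero_div]

theorem hasDerivAt_ellipticK_of_im_pos (ht0 : 0 < t) (ht1 : t < 1) {x : ℂ} (hr : 0 ≤ x.re)
    (hi : 0 < x.im) (hx : t * ‖x‖ ^ 2 ≤ 1) :
    HasDerivAt (fun x => ellipticK x t) (ellipticIntegrand t x) x :=
  hasDerivAt_ellipticK ht0 ht1 (mem_ellipticDomain_of_re_nonneg ht0 ht1 hr hx)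
    (mem_slitPlane_iff.2 (.inr (by simpa using hi.ne')))

theorem mul_norm_smul_sq_lt_one (ht0 : 0 < t) {x : ℂ} (hx : t * ‖x‖ ^ 2 ≤ 1) {s : ℝ}
    (h0 : 0 ≤ s) (h1 : s < 1) : t * ‖s * x‖ ^ 2 < 1 := by
  rw [norm_mul, norm_real, Real.norm_eq_abs, abs_of_nonneg h0, mul_pow]
  have h2 : s ^ 2 < 1 := by nlinarith
  have h3 : 0 ≤ t * ‖x‖ ^ 2 := by positivity
  nlinarith [sq_nonneg s]

theorem hasDerivAt_ellipticK_ray (ht0 : 0 < t) (ht1 : t < 1) {x : ℂ} (hr : 0 ≤ x.re)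
    (hi : 0 < x.im) (hx : t * ‖x‖ ^ 2 ≤ 1) {s : ℝ} (hs : s ∈ Icc (0 : ℝ) 1) :
    HasDerivAt (fun s : ℝ => ellipticK (s * x) t) (x * ellipticIntegrand t (s * x)) s := by
  have hm := smul_mem_ellipticDomain ht0 (mem_ellipticDomain_of_re_nonneg ht0 ht1 hr hx) hs
  have h1 := hasDerivAt_ellipticK ht0 ht1 hm (one_sub_smul_mem_slitPlane hi.ne' s)
  have h0 : HasDerivAt (fun r : ℝ => (r : ℂ) * x) x s := by
    have : HasDerivAt (fun r : ℝ => (r : ℂ)) 1 s := ofRealCLM.hasDerivAt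
    simpa using this.mul_const x
  refine (h1.comp s h0).congr_deriv ?_
  rw [mul_comm]
  rfl

/-- Along a ray the derivative of `K` is a positive multiple of `x K'(x)`, which lies in the open
first quadrant inside the arc. -/
theorem ellipticK_ray_lt (ht0 : 0 < t) (ht1 : t < 1) {x : ℂ} (hr : 0 < x.re)
    (hi : 0 < x.im) (hx : t * ‖x‖ ^ 2 ≤ 1) {a : ℝ} (ha : 0 ≤ a) (ha1 : a < 1) :
    (ellipticK (a * x) t).re < (ellipticK x t).re ∧
      (ellipticK (a * x) t).im < (ellipticK x t).im := by
  have hd : ∀ s ∈ Icc a 1, HasDerivAt (fun s : ℝ => ellipticK (s * x) t)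
      (x * ellipticIntegrand t (s * x)) s := fun s hs =>
    hasDerivAt_ellipticK_ray ht0 ht1 hr.le hi hx ⟨ha.trans hs.1, hs.2⟩
  have hpos : ∀ s ∈ Ioo a 1, 0 < s := fun s hs => ha.trans_lt hs.1
  have hmul : ∀ s ∈ Ioo a 1, x * ellipticIntegrand t (s * x)
      = ((s⁻¹ : ℝ) : ℂ) * (s * x * ellipticIntegrand t (s * x)) := fun s hs => by
    have : (s : ℂ) ≠ 0 := by exact_mod_cast (hpos s hs).ne'
    push_cast
    field_simp
  have hsr : ∀ s ∈ Ioo a 1, 0 < ((s : ℂ) * x).re ∧ 0 < ((s : ℂ) * x).im := fun s hs => by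
    rw [re_ofReal_mul, im_ofReal_mul]
    exact ⟨mul_pos (hpos s hs) hr, mul_pos (hpos s hs) hi⟩
  constructor
  · have hd' : ∀ s ∈ Icc a 1, HasDerivAt (fun s : ℝ => (ellipticK (s * x) t).re)
        (x * ellipticIntegrand t (s * x)).re s := fun s hs =>
      reCLM.hasFDerivAt.comp_hasDerivAt s (hd s hs)
    have := lt_of_hasDerivAt_pos ha1 (fun s hs => (hd' s hs).continuousAt.continuousWithinAt)
      (fun s hs => hd' s (Ioo_subset_Icc_self hs)) fun s hs => by
        rw [hmul s hs, re_ofReal_mul]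
        exact mul_pos (inv_pos.2 (hpos s hs)) (re_mul_ellipticIntegrand_pos ht0 (hsr s hs).1
          (hsr s hs).2 (mul_norm_smul_sq_lt_one ht0 hx (hpos s hs).le hs.2))
    simpa using this
  · have hd' : ∀ s ∈ Icc a 1, HasDerivAt (fun s : ℝ => (ellipticK (s * x) t).im)
        (x * ellipticIntegrand t (s * x)).im s := fun s hs =>
      imCLM.hasFDerivAt.comp_hasDerivAt s (hd s hs)
    have := lt_of_hasDerivAt_pos ha1 (fun s hs => (hd' s hs).continuousAt.continuousWithinAt)
      (fun s hs => hd' s (Ioo_subset_Icc_self hs)) fun s hs => by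
        rw [hmul s hs, im_ofReal_mul]
        exact mul_pos (inv_pos.2 (hpos s hs)) (im_mul_ellipticIntegrand_pos ht0 (hsr s hs).1
          (hsr s hs).2)
    simpa using this

theorem ellipticK_pos (ht0 : 0 < t) (ht1 : t < 1) {x : ℂ} (hr : 0 < x.re)
    (hi : 0 < x.im) (hx : t * ‖x‖ ^ 2 ≤ 1) :
    0 < (ellipticK x t).re ∧ 0 < (ellipticK x t).im := by
  have := ellipticK_ray_lt ht0 ht1 hr hi hx le_rfl zero_lt_one
  have h0 : ellipticK 0 t = 0 := by simp [ellipticK]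
  simpa [h0] using this

theorem ellipticK_re_lt (ht0 : 0 < t) (ht1 : t < 1) {x : ℂ} (hr : 0 < x.re)
    (hi : 0 < x.im) (hx : t * ‖x‖ ^ 2 ≤ 1) :
    (ellipticK x t).re < completeEllipticK t := by
  have hm := mem_ellipticDomain_of_re_nonneg ht0 ht1 hr.le hx
  rw [ellipticK_eq_sub ht0 ht1 hm, coEllipticK_one ht0 ht1, sub_re, ofReal_re]
  have hneg : (1 - x).im < 0 := by simpa using hi
  have := re_coEllipticK_pos (v := sqrt (1 - x)) ht0 ht1
    (sqrt_re_pos (mem_slitPlane_iff.2 (.inr hneg.ne))) (sqrt_im_neg hneg).le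
    (by rw [sqrt_sq, sub_sub_cancel]; exact hm) (by rw [sqrt_sq, sub_sub_cancel]; exact hr.le)
  linarith

theorem mul_norm_circleMap_sq (ht0 : 0 < t) (θ : ℝ) : t * ‖circleMap 0 (1 / √t) θ‖ ^ 2 = 1 := by
  rw [norm_circleMap_zero, sq_abs, div_pow, Real.sq_sqrt ht0.le]
  field_simp

theorem circleMap_re_pos (ht0 : 0 < t) {θ : ℝ} (hθ : θ ∈ Ioo 0 (π / 2)) :
    0 < (circleMap 0 (1 / √t) θ).re := by
  rw [circleMap, zero_add, re_ofReal_mul, exp_ofReal_mul_I_re]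
  exact mul_pos (by positivity) (Real.cos_pos_of_mem_Ioo ⟨by linarith [hθ.1, Real.pi_pos], hθ.2⟩)

theorem circleMap_im_pos (ht0 : 0 < t) {θ : ℝ} (hθ : θ ∈ Ioo 0 π) :
    0 < (circleMap 0 (1 / √t) θ).im := by
  rw [circleMap, zero_add, im_ofReal_mul, exp_ofReal_mul_I_im]
  exact mul_pos (by positivity) (Real.sin_pos_of_mem_Ioo hθ)

/-- The angular derivative of `K` is `i x K'(x)`, which is real on the arc because `x K'(x)` is
purely imaginary there. -/
theorem ellipticK_im_arc (ht0 : 0 < t) (ht1 : t < 1) {θ : ℝ} (hθ : θ ∈ Ioo 0 (π / 2)) :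
    (ellipticK (circleMap 0 (1 / √t) θ) t).im = (ellipticK ((1 / √t : ℝ) * I) t).im := by
  have hpi := Real.pi_pos
  have hd : ∀ φ ∈ Icc θ (π / 2), HasDerivAt
      (fun φ : ℝ => (ellipticK (circleMap 0 (1 / √t) φ) t).im)
      (I * (circleMap 0 (1 / √t) φ * ellipticIntegrand t (circleMap 0 (1 / √t) φ))).im φ := by
    intro φ hφ
    have hre : 0 ≤ (circleMap 0 (1 / √t) φ).re := by
      rw [circleMap, zero_add, re_ofReal_mul, exp_ofReal_mul_I_re]
      exact mul_nonneg (by positivity)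
        (Real.cos_nonneg_of_mem_Icc ⟨by linarith [hθ.1, hφ.1], hφ.2⟩)
    have h1 := hasDerivAt_ellipticK_of_im_pos ht0 ht1 hre
      (circleMap_im_pos ht0 ⟨hθ.1.trans_le hφ.1, by linarith [hφ.2]⟩)
      (mul_norm_circleMap_sq ht0 φ).le
    refine (imCLM.hasFDerivAt.comp_hasDerivAt φ
      (h1.comp φ (hasDerivAt_circleMap 0 (1 / √t) φ))).congr_deriv ?_
    simp only [imCLM_apply]
    congr 1
    ring
  have h := constant_of_derivWithin_zero
    (f := fun φ : ℝ => (ellipticK (circleMap 0 (1 / √t) φ) t).im) (a := θ) (b := π / 2)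
    (fun φ hφ => (hd φ hφ).differentiableAt.differentiableWithinAt) (fun φ hφ => by
      have hφ' : φ ∈ Icc θ (π / 2) := Ico_subset_Icc_self hφ
      have h0 : φ ∈ Ioo 0 (π / 2) := ⟨hθ.1.trans_le hφ.1, hφ.2⟩
      rw [(hd φ hφ').hasDerivWithinAt.derivWithin (uniqueDiffOn_Icc hθ.2 φ hφ'), I_mul_im]
      exact re_mul_ellipticIntegrand_eq_zero ht0 (circleMap_re_pos ht0 h0)
        (circleMap_im_pos ht0 ⟨h0.1, by linarith [h0.2]⟩) (mul_norm_circleMap_sq ht0 φ))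
    (π / 2) ⟨hθ.2.le, le_rfl⟩
  rw [← h]
  simp [circleMap, exp_mul_I]

theorem exists_circleMap_eq {x : ℂ} (hr : 0 < x.re) (hi : 0 < x.im) :
    ∃ θ ∈ Ioo 0 (π / 2), x = circleMap 0 ‖x‖ θ := by
  refine ⟨arg x, ⟨?_, ?_⟩, ?_⟩
  · exact lt_of_le_of_ne (arg_nonneg_iff.2 hi.le) fun h => by
      have := (arg_eq_zero_iff.1 h.symm).2
      exact hi.ne' this
  · exact arg_lt_pi_div_two_iff.2 (.inl hr)
  · rw [circleMap, zero_add, norm_mul_exp_arg_mul_I]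

theorem ellipticK_im_eq_of_norm (ht0 : 0 < t) (ht1 : t < 1) {x : ℂ} (hr : 0 < x.re)
    (hi : 0 < x.im) (hx : t * ‖x‖ ^ 2 = 1) :
    (ellipticK x t).im = (ellipticK ((1 / √t : ℝ) * I) t).im := by
  obtain ⟨θ, hθ, h⟩ := exists_circleMap_eq hr hi
  have hn : ‖x‖ = 1 / √t := by
    rw [← Real.sqrt_one, ← Real.sqrt_div zero_le_one, eq_comm, Real.sqrt_eq_iff_eq_sq
      (by positivity) (norm_nonneg _)]
    field_simp
    linarith
  rw [h, hn, ellipticK_im_arc ht0 ht1 hθ]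

theorem ellipticK_im_lt (ht0 : 0 < t) (ht1 : t < 1) {x : ℂ} (hr : 0 < x.re)
    (hi : 0 < x.im) (hx : t * ‖x‖ ^ 2 < 1) :
    (ellipticK x t).im < (ellipticK ((1 / √t : ℝ) * I) t).im := by
  have hx0 : x ≠ 0 := fun h => by simp [h] at hr
  have hn : 0 < ‖x‖ := norm_pos_iff.2 hx0
  -- `a⁻¹ x` is the radial projection of `x` to the arc, where the imaginary part is known.
  set a : ℝ := √t * ‖x‖ with ha
  have ha0 : 0 < a := by positivity
  have ha2 : a ^ 2 = t * ‖x‖ ^ 2 := by rw [ha, mul_pow, Real.sq_sqrt ht0.le]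
  have ha1 : a < 1 := by nlinarith
  have hy : (a : ℂ) * ((a⁻¹ : ℝ) * x) = x := by
    have : (a : ℂ) ≠ 0 := by exact_mod_cast ha0.ne'
    push_cast
    field_simp
  have hyr : 0 < (((a⁻¹ : ℝ) : ℂ) * x).re := by rw [re_ofReal_mul]; positivity
  have hyi : 0 < (((a⁻¹ : ℝ) : ℂ) * x).im := by rw [im_ofReal_mul]; positivity
  have hyn : t * ‖((a⁻¹ : ℝ) : ℂ) * x‖ ^ 2 = 1 := by
    rw [norm_mul, norm_real, Real.norm_eq_abs, abs_of_pos (inv_pos.2 ha0), mul_pow, inv_pow,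
      mul_left_comm, ← ha2]
    exact inv_mul_cancel₀ (by positivity)
  have := (ellipticK_ray_lt ht0 ht1 hyr hyi hyn.le ha0.le ha1).2
  rwa [hy, ellipticK_im_eq_of_norm ht0 ht1 hyr hyi hyn] at this

/-- The Noshiro–Warschawski argument: `(K(y) - K(x)) / (y - x)` is the mean of `K'` over the
segment, and `Im K' > 0` in the quadrant. -/
theorem ellipticK_injOn_quadrant (ht0 : 0 < t) (ht1 : t < 1) {x y : ℂ} (hxr : 0 < x.re)
    (hxi : 0 < x.im) (hx : t * ‖x‖ ^ 2 ≤ 1) (hyr : 0 < y.re) (hyi : 0 < y.im)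
    (hy : t * ‖y‖ ^ 2 ≤ 1) (h : ellipticK x t = ellipticK y t) : x = y := by
  by_contra hne
  have hn : y - x ≠ 0 := sub_ne_zero.2 (Ne.symm hne)
  have hre : ∀ s ∈ Icc (0 : ℝ) 1, 0 < (x + s * (y - x)).re := fun s hs => by
    simp only [add_re, re_ofReal_mul, sub_re]
    rcases eq_or_lt_of_le hs.1 with h0 | h0
    · rw [← h0]; linarith
    · nlinarith [hs.2, mul_pos h0 hyr, mul_nonneg (sub_nonneg.2 hs.2) hxr.le]
  have him : ∀ s ∈ Icc (0 : ℝ) 1, 0 < (x + s * (y - x)).im := fun s hs => by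
    simp only [add_im, im_ofReal_mul, sub_im]
    rcases eq_or_lt_of_le hs.1 with h0 | h0
    · rw [← h0]; linarith
    · nlinarith [hs.2, mul_pos h0 hyi, mul_nonneg (sub_nonneg.2 hs.2) hxi.le]
  have hmem : ∀ s ∈ Icc (0 : ℝ) 1, x + s * (y - x) ∈ ellipticDomain t := fun s hs => by
    have := convex_ellipticDomain (mem_ellipticDomain_of_re_nonneg ht0 ht1 hyr.le hy)
      (mem_ellipticDomain_of_re_nonneg ht0 ht1 hxr.le hx) hs.1 (sub_nonneg.2 hs.2) (by ring)
    convert this using 1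
    simp only [real_smul]
    push_cast
    ring
  have hd : ∀ s ∈ Icc (0 : ℝ) 1, HasDerivAt
      (fun s : ℝ => (ellipticK (x + s * (y - x)) t / (y - x)).im)
      (ellipticIntegrand t (x + s * (y - x))).im s := by
    intro s hs
    have h1 := hasDerivAt_ellipticK ht0 ht1 (hmem s hs)
      (mem_slitPlane_iff.2 (.inr (ne_of_lt (by rw [sub_im, one_im]; linarith [him s hs]))))
    have h0 : HasDerivAt (fun r : ℝ => x + (r : ℂ) * (y - x)) (y - x) s := by
      have : HasDerivAt (fun r : ℝ => (r : ℂ)) 1 s := ofRealCLM.hasDerivAt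
      simpa using (this.mul_const (y - x)).const_add x
    refine (imCLM.hasFDerivAt.comp_hasDerivAt s ((h1.comp s h0).div_const (y - x))).congr_deriv ?_
    simp only [imCLM_apply]
    rw [mul_div_cancel_right₀ _ hn, ellipticIntegrand]
  have := lt_of_hasDerivAt_pos zero_lt_one
    (fun s hs => (hd s hs).continuousAt.continuousWithinAt)
    (fun s hs => hd s (Ioo_subset_Icc_self hs)) fun s hs =>
      ellipticIntegrand_im_pos ht0 (hre s (Ioo_subset_Icc_self hs)) (him s (Ioo_subset_Icc_self hs))
  simp [h] at this

end

/-! ### The complementary complete integral as `2 Im K(i/√t, t)` -/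

section

/-- A nonnegative derivative of a continuous function is automatically integrable, which takes care
of the endpoint singularity at `s = 1`. -/
theorem integral_eq_sub_of_hasDerivAt_nonneg {f f' : ℝ → ℝ} {a b : ℝ} (hab : a ≤ b)
    (hc : ContinuousOn f (Icc a b)) (hd : ∀ s ∈ Ioo a b, HasDerivAt f (f' s) s)
    (hp : ∀ s ∈ Ioo a b, 0 ≤ f' s) :
    IntervalIntegrable f' volume a b ∧ ∫ s in a..b, f' s = f b - f a := by
  have hi : IntervalIntegrable f' volume a b :=
    intervalIntegral.intervalIntegrable_deriv_of_nonneg (by rwa [uIcc_of_le hab])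
      (by rwa [min_eq_left hab, max_eq_right hab]) (by rwa [min_eq_left hab, max_eq_right hab])
  exact ⟨hi, intervalIntegral.integral_eq_sub_of_hasDerivAt_of_le hab hc hd hi⟩

variable {t : ℝ}

theorem hasDerivAt_ellipticK_imaginary (ht0 : 0 < t) (ht1 : t < 1) {y : ℝ}
    (hy : t * y ^ 2 ≤ 1) :
    HasDerivAt (fun y : ℝ => (ellipticK (y * I) t).im)
      (1 / √((1 + y ^ 2) * (1 + t ^ 2 * y ^ 2))) y := by
  have hm : (y : ℂ) * I ∈ ellipticDomain t :=
    mem_ellipticDomain_of_re_nonneg ht0 ht1 (by simp) (by simpa using hy)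
  have h1 := hasDerivAt_ellipticK ht0 ht1 hm (mem_slitPlane_iff.2 (.inl (by simp)))
  have h0 : HasDerivAt (fun r : ℝ => (r : ℂ) * I) I y := by
    have : HasDerivAt (fun r : ℝ => (r : ℂ)) 1 y := ofRealCLM.hasDerivAt
    simpa using this.mul_const I
  have e1 : (1 : ℂ) - ((y : ℂ) * I) ^ 2 = ((1 + y ^ 2 : ℝ) : ℂ) := by
    rw [mul_pow, I_sq]; push_cast; ring
  have e2 : (1 : ℂ) - (t : ℂ) ^ 2 * ((y : ℂ) * I) ^ 2 = ((1 + t ^ 2 * y ^ 2 : ℝ) : ℂ) := by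
    rw [mul_pow, I_sq]; push_cast; ring
  refine (imCLM.hasFDerivAt.comp_hasDerivAt y (h1.comp y h0)).congr_deriv ?_
  rw [e1, e2, sqrt_ofReal, sqrt_ofReal, Real.sqrt_eq_zero_of_nonpos (x := -(1 + y ^ 2))
    (by nlinarith [sq_nonneg y]), Real.sqrt_eq_zero_of_nonpos (x := -(1 + t ^ 2 * y ^ 2))
    (by nlinarith [sq_nonneg (t * y)]), Real.sqrt_mul (by positivity)]
  simp only [ofReal_zero, zero_mul, add_zero, ← ofReal_mul, ← ofReal_one, ← ofReal_div, imCLM_apply,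
    im_ofReal_mul, I_im, mul_one]

theorem sqrt_one_sub_sq_mul_sq_pos (ht0 : 0 < t) {s : ℝ} (hs : s ^ 2 ≤ 1) :
    0 < 1 - (1 - t ^ 2) * s ^ 2 := by
  rcases eq_or_ne s 0 with rfl | h
  · simp
  · have : 0 < t ^ 2 * s ^ 2 := by positivity
    nlinarith

/-- The substitution `u = s / √(1 - s²)` turns the integral into that of `1 / √((1 + u²)(1 + t²u²))`
over `(0, ∞)`. The involution `u ↦ 1/(tu)` preserves this integral and swaps the two sides of `u =
1/√t`, so each side contributes `Im K(i/√t)`. -/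
theorem completeEllipticK_complementary (ht0 : 0 < t) (ht1 : t < 1) :
    completeEllipticK √(1 - t ^ 2) = 2 * (ellipticK ((1 / √t : ℝ) * I) t).im := by
  set J : ℝ → ℝ := fun y => (ellipticK (y * I) t).im with hJ
  have hJd : ∀ y : ℝ, t * y ^ 2 ≤ 1 →
      HasDerivAt J (1 / √((1 + y ^ 2) * (1 + t ^ 2 * y ^ 2))) y :=
    fun y hy => hasDerivAt_ellipticK_imaginary ht0 ht1 hy
  have hk : √(1 - t ^ 2) ^ 2 = 1 - t ^ 2 := Real.sq_sqrt (by nlinarith)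
  set g : ℝ → ℝ := fun s => 1 / √((1 - s ^ 2) * (1 - √(1 - t ^ 2) ^ 2 * s ^ 2)) with hg
  -- The value of `s` at which `u = 1/√t`.
  set s₀ : ℝ := 1 / √(1 + t) with hs₀
  have hs₀p : 0 < s₀ := by positivity
  have hs₀2 : s₀ ^ 2 = 1 / (1 + t) := by
    rw [hs₀, div_pow, Real.sq_sqrt (by linarith), one_pow]
  have hs₀1 : s₀ < 1 := by
    have : s₀ ^ 2 < 1 := by rw [hs₀2, div_lt_one (by linarith)]; linarith
    nlinarith
  have hroot : ∀ s ∈ Ioo (0 : ℝ) 1, HasDerivAt (fun s : ℝ => √(1 - s ^ 2)) (-s / √(1 - s ^ 2)) s := by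
    intro s hs
    have h1 : HasDerivAt (fun s : ℝ => 1 - s ^ 2) (-(2 * s)) s := by
      simpa using (hasDerivAt_pow 2 s).const_sub 1
    refine (h1.sqrt (by nlinarith [hs.1, hs.2])).congr_deriv ?_
    rw [neg_div, neg_div, mul_div_mul_left _ _ two_ne_zero]
  have hgm : ∀ s ∈ Ioo (0 : ℝ) 1, g s = 1 / (√(1 - s ^ 2) * √(1 - (1 - t ^ 2) * s ^ 2)) := by
    intro s hs
    simp only [hg]
    rw [hk, Real.sqrt_mul (by nlinarith [hs.1, hs.2])]
  have hr : ∀ s ∈ Ioo (0 : ℝ) 1, 0 < √(1 - s ^ 2) ∧ √(1 - s ^ 2) ^ 2 = 1 - s ^ 2 := fun s hs =>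
    have : 0 < 1 - s ^ 2 := by nlinarith [hs.1, hs.2]
    ⟨Real.sqrt_pos.2 this, Real.sq_sqrt this.le⟩
  have hmm : ∀ s ∈ Ioo (0 : ℝ) 1, 0 < √(1 - (1 - t ^ 2) * s ^ 2) ∧
      √(1 - (1 - t ^ 2) * s ^ 2) ^ 2 = 1 - (1 - t ^ 2) * s ^ 2 := fun s hs =>
    have : 0 < 1 - (1 - t ^ 2) * s ^ 2 :=
      sqrt_one_sub_sq_mul_sq_pos ht0 (by nlinarith [hs.1, hs.2])
    ⟨Real.sqrt_pos.2 this, Real.sq_sqrt this.le⟩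
  have hgpos : ∀ s ∈ Ioo (0 : ℝ) 1, 0 ≤ g s := fun s _ => by simp only [hg]; positivity
  have hb1 : ∀ s ∈ Icc 0 s₀, t * (s / √(1 - s ^ 2)) ^ 2 ≤ 1 := by
    intro s hs
    have h2 : s ^ 2 ≤ 1 / (1 + t) := by rw [← hs₀2]; nlinarith [hs.1, hs.2]
    rw [le_div_iff₀ (by linarith)] at h2
    have h3 : 0 < 1 - s ^ 2 := by nlinarith [hs.1, hs.2]
    rw [div_pow, Real.sq_sqrt h3.le, ← mul_div_assoc, div_le_one h3]
    linarith
  have hb2 : ∀ s ∈ Icc s₀ 1, t * (√(1 - s ^ 2) / (t * s)) ^ 2 ≤ 1 := by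
    intro s hs
    have hsp : 0 < s := hs₀p.trans_le hs.1
    have h2 : 1 / (1 + t) ≤ s ^ 2 := by rw [← hs₀2]; nlinarith [hs.1, hs.2]
    rw [div_le_iff₀ (by linarith)] at h2
    have h3 : 0 ≤ 1 - s ^ 2 := by nlinarith [hs.1, hs.2]
    rw [div_pow, Real.sq_sqrt h3, ← mul_div_assoc, div_le_one (by positivity)]
    nlinarith
  have hsqrtc : Continuous fun s : ℝ => √(1 - s ^ 2) := by fun_prop
  have hA := integral_eq_sub_of_hasDerivAt_nonneg (f := fun s => J (s / √(1 - s ^ 2))) (f' := g)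
    hs₀p.le
    (fun s hs => by
      have hne : √(1 - s ^ 2) ≠ 0 := (Real.sqrt_pos.2 (by nlinarith [hs.1, hs.2])).ne'
      exact (ContinuousAt.comp (f := fun s : ℝ => s / √(1 - s ^ 2))
        (hJd _ (hb1 s hs)).continuousAt
        (continuousAt_id.div hsqrtc.continuousAt hne)).continuousWithinAt)
    (fun s hs => by
      have hs' : s ∈ Ioo (0 : ℝ) 1 := ⟨hs.1, hs.2.trans hs₀1⟩
      obtain ⟨r0, r2⟩ := hr s hs'
      obtain ⟨m0, m2⟩ := hmm s hs'
      have h1 := (hasDerivAt_id s).div (hroot s hs') r0.ne'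
      have h2 := (hJd _ (hb1 s (Ioo_subset_Icc_self hs))).comp s h1
      refine h2.congr_deriv ?_
      rw [hgm s hs']
      set r := √(1 - s ^ 2)
      set m := √(1 - (1 - t ^ 2) * s ^ 2)
      have e : (1 + (s / r) ^ 2) * (1 + t ^ 2 * (s / r) ^ 2) = (m / r ^ 2) ^ 2 := by
        field_simp
        rw [m2, r2]
        ring
      rw [e, Real.sqrt_sq (by positivity)]
      simp only [id]
      field_simp
      rw [r2]
      ring)
    (fun s hs => hgpos s ⟨hs.1, hs.2.trans hs₀1⟩)
  -- Beyond `s₀` the primitive is taken through `1/(tu) = √(1 - s²)/(ts)`, which keeps the argument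
  -- of `J` in the range where its derivative is known.
  have hB := integral_eq_sub_of_hasDerivAt_nonneg
    (f := fun s => -J (√(1 - s ^ 2) / (t * s))) (f' := g) hs₀1.le
    (fun s hs => by
      have hne : t * s ≠ 0 := (mul_pos ht0 (hs₀p.trans_le hs.1)).ne'
      exact (ContinuousAt.comp (f := fun s : ℝ => √(1 - s ^ 2) / (t * s))
        (hJd _ (hb2 s hs)).continuousAt
        (hsqrtc.continuousAt.div (by fun_prop) hne)).neg.continuousWithinAt)
    (fun s hs => by
      have hs' : s ∈ Ioo (0 : ℝ) 1 := ⟨hs₀p.trans hs.1, hs.2⟩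
      have hsp := hs'.1
      obtain ⟨r0, r2⟩ := hr s hs'
      obtain ⟨m0, m2⟩ := hmm s hs'
      have h1 := (hroot s hs').div ((hasDerivAt_id s).const_mul t) (mul_pos ht0 hsp).ne'
      have h2 := ((hJd _ (hb2 s (Ioo_subset_Icc_self hs))).comp s h1).neg
      refine h2.congr_deriv ?_
      rw [hgm s hs']
      set r := √(1 - s ^ 2)
      set m := √(1 - (1 - t ^ 2) * s ^ 2)
      have e : (1 + (r / (t * s)) ^ 2) * (1 + t ^ 2 * (r / (t * s)) ^ 2)
          = (m / (t * s ^ 2)) ^ 2 := by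
        field_simp
        rw [m2, r2]
        ring
      simp only [id]
      rw [e, Real.sqrt_sq (by positivity)]
      field_simp
      rw [r2]
      ring)
    (fun s hs => hgpos s ⟨hs₀p.trans hs.1, hs.2⟩)
  have hroot0 : √(1 - s₀ ^ 2) = √t * s₀ := by
    have : 1 - s₀ ^ 2 = t * s₀ ^ 2 := by rw [hs₀2]; field_simp; ring
    rw [this, Real.sqrt_mul ht0.le, Real.sqrt_sq hs₀p.le]
  have hy1 : s₀ / √(1 - s₀ ^ 2) = 1 / √t := by
    rw [hroot0]; field_simp
  have hy2 : √(1 - s₀ ^ 2) / (t * s₀) = 1 / √t := by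
    rw [hroot0]
    have := Real.mul_self_sqrt ht0.le
    have h0 : √t ≠ 0 := (Real.sqrt_pos.2 ht0).ne'
    field_simp
    linarith
  have hJ0 : J 0 = 0 := by simp [hJ, ellipticK]
  have hsum := intervalIntegral.integral_add_adjacent_intervals hA.1 hB.1
  rw [hA.2, hB.2, hy1, hy2] at hsum
  simp only [zero_div, one_pow, sub_self, Real.sqrt_zero, hJ0] at hsum
  change ∫ s in (0 : ℝ)..1, g s = 2 * J (1 / √t)
  rw [← hsum]
  ring

theorem ellipticMu_half (ht0 : 0 < t) (ht1 : t < 1) :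
    ellipticMu t / 2
      = π / (2 * completeEllipticK t) * (ellipticK ((1 / √t : ℝ) * I) t).im := by
  rw [ellipticMu, completeEllipticK_complementary ht0 ht1]
  have := (completeEllipticK_pos ht0 ht1).ne'
  field_simp

end

/-! ### Ellipses, the complex sine, and perturbation off the axes -/

/-- The quadratic form whose sublevel set is `ellipseRegion ξ`. -/
def ellipseForm (ξ : ℝ) (w : ℂ) : ℝ := w.re ^ 2 / Real.cosh ξ ^ 2 + w.im ^ 2 / Real.sinh ξ ^ 2

theorem mem_ellipseRegion {ξ : ℝ} {w : ℂ} : w ∈ ellipseRegion ξ ↔ ellipseForm ξ w < 1 := Iff.rfl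

theorem ellipseForm_neg (ξ : ℝ) (w : ℂ) : ellipseForm ξ (-w) = ellipseForm ξ w := by
  simp [ellipseForm]

theorem ellipseForm_conj (ξ : ℝ) (w : ℂ) : ellipseForm ξ (conj w) = ellipseForm ξ w := by
  simp [ellipseForm]

theorem ellipseForm_smul (ξ r : ℝ) (w : ℂ) :
    ellipseForm ξ (r * w) = r ^ 2 * ellipseForm ξ w := by
  simp only [ellipseForm, re_ofReal_mul, im_ofReal_mul]
  ring

theorem ellipseForm_nonneg (ξ : ℝ) (w : ℂ) : 0 ≤ ellipseForm ξ w := by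
  unfold ellipseForm; positivity

theorem continuous_ellipseForm (ξ : ℝ) : Continuous (ellipseForm ξ) := by
  unfold ellipseForm; fun_prop

theorem sin_re (z : ℂ) : (Complex.sin z).re = Real.sin z.re * Real.cosh z.im := by
  conv_lhs => rw [← re_add_im z, Complex.sin_add_mul_I]
  simp [← ofReal_sin, ← ofReal_cos, ← ofReal_sinh, ← ofReal_cosh]

theorem sin_im (z : ℂ) : (Complex.sin z).im = Real.cos z.re * Real.sinh z.im := by
  conv_lhs => rw [← re_add_im z, Complex.sin_add_mul_I]
  simp [← ofReal_sin, ← ofReal_cos, ← ofReal_sinh, ← ofReal_cosh]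

theorem ellipseForm_sin_eq_one {ξ : ℝ} (hξ : 0 < ξ) {z : ℂ} (hz : z.im = ξ) :
    ellipseForm ξ (Complex.sin z) = 1 := by
  have h1 := (Real.cosh_pos ξ).ne'
  have h2 := (Real.sinh_pos_iff.2 hξ).ne'
  rw [ellipseForm, sin_re, sin_im, hz]
  field_simp
  exact Real.sin_sq_add_cos_sq _

theorem ellipseForm_sin_lt_one {ξ : ℝ} {z : ℂ} (h0 : 0 < z.im) (hz : z.im < ξ) :
    ellipseForm ξ (Complex.sin z) < 1 := by
  have hs0 := Real.sinh_pos_iff.2 h0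
  have hs := Real.sinh_lt_sinh.2 hz
  have hc0 := Real.cosh_pos z.im
  have hc := Real.cosh_lt_cosh.2 (show |z.im| < |ξ| by
    rwa [abs_of_pos h0, abs_of_pos (h0.trans hz)])
  rw [ellipseForm, sin_re, sin_im, mul_pow, mul_pow, mul_div_assoc, mul_div_assoc, ← div_pow,
    ← div_pow]
  have h1 : (Real.cosh z.im / Real.cosh ξ) ^ 2 < 1 :=
    pow_lt_one₀ (by positivity) ((div_lt_one (hc0.trans hc)).2 hc) two_ne_zero
  have h2 : (Real.sinh z.im / Real.sinh ξ) ^ 2 < 1 :=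
    pow_lt_one₀ (div_nonneg hs0.le (hs0.trans hs).le) ((div_lt_one (hs0.trans hs)).2 hs)
      two_ne_zero
  have h3 := Real.sin_sq_add_cos_sq z.re
  rcases eq_or_ne (Real.sin z.re) 0 with h | h
  · rw [h] at h3 ⊢
    nlinarith
  · have := sq_pos_of_pos (abs_pos.2 h)
    rw [sq_abs] at this
    nlinarith [sq_nonneg (Real.cos z.re)]

theorem sin_injOn_strip {z w : ℂ} (hz : z.re ∈ Ioo 0 (π / 2)) (hw : w.re ∈ Ioo 0 (π / 2))
    (h : Complex.sin z = Complex.sin w) : z = w := by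
  have hpi := Real.pi_pos
  obtain ⟨k, hk | hk⟩ := Complex.sin_eq_sin_iff.1 h
  · have hre := congrArg re hk
    have e : (2 * (k : ℂ) * π + z) = ((2 * k * π : ℝ) : ℂ) + z := by push_cast; rfl
    rw [e, add_re, ofReal_re] at hre
    have h1 : k < 1 := by
      by_contra! hk1
      have : (1 : ℝ) ≤ k := by exact_mod_cast hk1
      nlinarith [hz.1, hw.2]
    have h2 : -1 < k := by
      by_contra! hk1
      have : (k : ℝ) ≤ -1 := by exact_mod_cast hk1
      nlinarith [hz.2, hw.1]
    have h3 : k = 0 := by omega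
    subst h3
    simpa using hk.symm
  · exfalso
    have hre := congrArg re hk
    have e : ((2 * (k : ℂ) + 1) * π - z) = (((2 * k + 1) * π : ℝ) : ℂ) - z := by push_cast; rfl
    rw [e, sub_re, ofReal_re] at hre
    have h1 : k < 0 := by
      by_contra! hk1
      have : (0 : ℝ) ≤ k := by exact_mod_cast hk1
      nlinarith [hz.2, hw.2]
    have h2 : (k : ℝ) ≤ -1 := by exact_mod_cast (show k ≤ -1 by omega)
    nlinarith [hz.1, hw.1]

/-- The diagonal perturbation leaves both axes at once; it transfers statements proved off the axes
to points on them. -/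
theorem eventually_off_axes (z : ℂ) :
    ∀ᶠ δ : ℝ in 𝓝[>] 0, (z + δ * (1 + I)).re ≠ 0 ∧ (z + δ * (1 + I)).im ≠ 0 := by
  have key : ∀ a : ℝ, ∀ᶠ δ : ℝ in 𝓝[>] 0, a + δ ≠ 0 := by
    intro a
    rcases eq_or_ne a 0 with rfl | ha
    · filter_upwards [self_mem_nhdsWithin] with δ hδ
      simpa using (ne_of_gt hδ)
    · refine nhdsWithin_le_nhds ((?_ : ContinuousAt (fun δ : ℝ => a + δ) 0).eventually_ne ?_)
      · fun_prop
      · simpa using ha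
  filter_upwards [key z.re, key z.im] with δ h1 h2
  simpa using ⟨h1, h2⟩

theorem tendsto_off_axes (z : ℂ) :
    Tendsto (fun δ : ℝ => z + δ * (1 + I)) (𝓝[>] 0) (𝓝 z) := by
  have : Continuous fun δ : ℝ => z + δ * (1 + I) := by fun_prop
  have h := this.tendsto 0
  simp only [ofReal_zero, zero_mul, add_zero] at h
  exact h.mono_left nhdsWithin_le_nhds

theorem starConvex_ellipseRegion (ξ : ℝ) : StarConvex ℝ 0 (ellipseRegion ξ) := by
  refine starConvex_zero_iff.2 fun w hw a ha ha1 => ?_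
  rw [mem_ellipseRegion] at hw ⊢
  rw [real_smul, ellipseForm_smul]
  have : a ^ 2 ≤ 1 := by nlinarith
  nlinarith [ellipseForm_nonneg ξ w]

/-! ### The conformal map of the disc onto the ellipse -/

section
variable {t : ℝ}

theorem mul_norm_div_sqrt_sq (ht0 : 0 < t) (z : ℂ) : t * ‖z / (√t : ℝ)‖ ^ 2 = ‖z‖ ^ 2 := by
  rw [norm_div, norm_real, Real.norm_eq_abs, abs_of_nonneg (Real.sqrt_nonneg t), div_pow,
    Real.sq_sqrt ht0.le]
  field_simp

theorem norm_div_sqrt_lt (ht0 : 0 < t) {z : ℂ} (hz : ‖z‖ < 1 / √t) :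
    ‖z / (√t : ℝ)‖ < 1 / t := by
  have h : 0 < √t := Real.sqrt_pos.2 ht0
  rw [norm_div, norm_real, Real.norm_eq_abs, abs_of_pos h, div_lt_iff₀ h]
  refine hz.trans_eq ?_
  nth_rw 2 [← Real.mul_self_sqrt ht0.le]
  field_simp

theorem one_lt_one_div_sqrt (ht0 : 0 < t) (ht1 : t < 1) : 1 < 1 / √t :=
  (one_lt_div (Real.sqrt_pos.2 ht0)).2 ((Real.sqrt_lt' one_pos).2 (by simpa using ht1))

theorem differentiableOn_ellipseMap (ht0 : 0 < t) (ht1 : t < 1) :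
    DifferentiableOn ℂ (ellipseMap t) (Metric.ball 0 (1 / √t)) :=
  (differentiableOn_sinEllipticK ht0 ht1).comp (g := sinEllipticK t)
    (f := fun z : ℂ => z / (√t : ℝ)) (by fun_prop)
    fun z hz => by simpa using norm_div_sqrt_lt ht0 (by simpa using hz)

theorem ellipseMap_neg (z : ℂ) : ellipseMap t (-z) = -ellipseMap t z := by
  rw [ellipseMap_eq, ellipseMap_eq, neg_div, sinEllipticK_neg]

theorem ellipseMap_conj (ht0 : 0 < t) (ht1 : t < 1) {z : ℂ} (hz : ‖z‖ < 1 / √t) :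
    ellipseMap t (conj z) = conj (ellipseMap t z) := by
  rw [ellipseMap_eq, ellipseMap_eq, ← sinEllipticK_conj ht0 ht1 (norm_div_sqrt_lt ht0 hz),
    map_div₀, conj_ofReal]

theorem ellipseMap_eq_sin (ht0 : 0 < t) (ht1 : t < 1) (z : ℂ) :
    ellipseMap t z = Complex.sin ((π / (2 * completeEllipticK t) : ℝ) *
      ellipticK (z / (√t : ℝ)) t) := by
  rw [ellipseMap_eq, sinEllipticK_eq_sin ht0 ht1]

theorem div_sqrt_re_im_pos (ht0 : 0 < t) {z : ℂ} (hr : 0 < z.re) (hi : 0 < z.im) :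
    0 < (z / (√t : ℝ)).re ∧ 0 < (z / (√t : ℝ)).im := by
  rw [div_ofReal_re, div_ofReal_im]
  constructor <;> positivity

theorem angle_mem_Ioo (ht0 : 0 < t) (ht1 : t < 1) {z : ℂ} (hr : 0 < z.re) (hi : 0 < z.im)
    (hz : ‖z‖ ≤ 1) :
    ((π / (2 * completeEllipticK t) : ℝ) * ellipticK (z / (√t : ℝ)) t).re ∈ Ioo 0 (π / 2) ∧
    0 < ((π / (2 * completeEllipticK t) : ℝ) * ellipticK (z / (√t : ℝ)) t).im := by
  obtain ⟨h1, h2⟩ := div_sqrt_re_im_pos ht0 hr hi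
  have h3 : t * ‖z / (√t : ℝ)‖ ^ 2 ≤ 1 := by
    rw [mul_norm_div_sqrt_sq ht0]; exact pow_le_one₀ (norm_nonneg _) hz
  have hK := completeEllipticK_pos ht0 ht1
  have hc : 0 < π / (2 * completeEllipticK t) := by positivity
  obtain ⟨h4, h5⟩ := ellipticK_pos ht0 ht1 h1 h2 h3
  have h6 := ellipticK_re_lt ht0 ht1 h1 h2 h3
  rw [re_ofReal_mul, im_ofReal_mul]
  refine ⟨⟨mul_pos hc h4, (mul_lt_mul_of_pos_left h6 hc).trans_eq ?_⟩, mul_pos hc h5⟩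
  field_simp

theorem ellipticMu_pos (ht0 : 0 < t) (ht1 : t < 1) : 0 < ellipticMu t := by
  have hK := completeEllipticK_pos ht0 ht1
  have hK' := completeEllipticK_pos (t := √(1 - t ^ 2)) (Real.sqrt_pos.2 (by nlinarith))
    ((Real.sqrt_lt' one_pos).2 (by nlinarith))
  have := Real.pi_pos
  unfold ellipticMu
  positivity

theorem ellipseMap_mem_quadrant (ht0 : 0 < t) (ht1 : t < 1) {z : ℂ} (hr : 0 < z.re)
    (hi : 0 < z.im) (hz : ‖z‖ ≤ 1) :
    0 < (ellipseMap t z).re ∧ 0 < (ellipseMap t z).im := by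
  obtain ⟨h1, h2⟩ := angle_mem_Ioo ht0 ht1 hr hi hz
  have hpi := Real.pi_pos
  rw [ellipseMap_eq_sin ht0 ht1, sin_re, sin_im]
  exact ⟨mul_pos (Real.sin_pos_of_mem_Ioo ⟨h1.1, by linarith [h1.2]⟩) (Real.cosh_pos _),
    mul_pos (Real.cos_pos_of_mem_Ioo ⟨by linarith [h1.1], h1.2⟩) (Real.sinh_pos_iff.2 h2)⟩

theorem ellipseForm_ellipseMap_lt_one_quadrant (ht0 : 0 < t) (ht1 : t < 1) {z : ℂ} (hr : 0 < z.re)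
    (hi : 0 < z.im) (hz : ‖z‖ < 1) : ellipseForm (ellipticMu t / 2) (ellipseMap t z) < 1 := by
  obtain ⟨h1, h2⟩ := angle_mem_Ioo ht0 ht1 hr hi hz.le
  have hK := completeEllipticK_pos ht0 ht1
  have hc : 0 < π / (2 * completeEllipticK t) := by positivity
  obtain ⟨h3, h4⟩ := div_sqrt_re_im_pos ht0 hr hi
  rw [ellipseMap_eq_sin ht0 ht1]
  refine ellipseForm_sin_lt_one h2 ?_
  rw [im_ofReal_mul, ellipticMu_half ht0 ht1]
  refine mul_lt_mul_of_pos_left (ellipticK_im_lt ht0 ht1 h3 h4 ?_) hc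
  rw [mul_norm_div_sqrt_sq ht0]
  exact pow_lt_one₀ (norm_nonneg _) hz two_ne_zero

theorem ellipseForm_ellipseMap_eq_one_quadrant (ht0 : 0 < t) (ht1 : t < 1) {z : ℂ}
    (hr : 0 < z.re) (hi : 0 < z.im) (hz : ‖z‖ = 1) :
    ellipseForm (ellipticMu t / 2) (ellipseMap t z) = 1 := by
  obtain ⟨h3, h4⟩ := div_sqrt_re_im_pos ht0 hr hi
  rw [ellipseMap_eq_sin ht0 ht1]
  refine ellipseForm_sin_eq_one (half_pos (ellipticMu_pos ht0 ht1)) ?_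
  rw [im_ofReal_mul, ellipticMu_half ht0 ht1, ellipticK_im_eq_of_norm ht0 ht1 h3 h4]
  rw [mul_norm_div_sqrt_sq ht0, hz, one_pow]

theorem ellipseMap_injOn_quadrant (ht0 : 0 < t) (ht1 : t < 1) {z w : ℂ} (hzr : 0 < z.re)
    (hzi : 0 < z.im) (hz : ‖z‖ ≤ 1) (hwr : 0 < w.re) (hwi : 0 < w.im) (hw : ‖w‖ ≤ 1)
    (h : ellipseMap t z = ellipseMap t w) : z = w := by
  have hK := completeEllipticK_pos ht0 ht1
  have hc : ((π / (2 * completeEllipticK t) : ℝ) : ℂ) ≠ 0 := by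
    have := Real.pi_pos
    exact_mod_cast (by positivity : π / (2 * completeEllipticK t) ≠ 0)
  rw [ellipseMap_eq_sin ht0 ht1, ellipseMap_eq_sin ht0 ht1] at h
  have h1 := mul_left_cancel₀ hc (sin_injOn_strip (angle_mem_Ioo ht0 ht1 hzr hzi hz).1
    (angle_mem_Ioo ht0 ht1 hwr hwi hw).1 h)
  obtain ⟨h3, h4⟩ := div_sqrt_re_im_pos ht0 hzr hzi
  obtain ⟨h5, h6⟩ := div_sqrt_re_im_pos ht0 hwr hwi
  have h2 := ellipticK_injOn_quadrant ht0 ht1 h3 h4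
    (by rw [mul_norm_div_sqrt_sq ht0]; exact pow_le_one₀ (norm_nonneg _) hz) h5 h6
    (by rw [mul_norm_div_sqrt_sq ht0]; exact pow_le_one₀ (norm_nonneg _) hw) h1
  have hs : ((√t : ℝ) : ℂ) ≠ 0 := by exact_mod_cast (Real.sqrt_pos.2 ht0).ne'
  exact (div_left_inj' hs).1 h2

/-- Off the axes, one of the symmetries `z ↦ ±z, ±conj z` moves `z` into the open first quadrant. -/
theorem exists_reflection {z : ℂ} (hr : z.re ≠ 0) (hi : z.im ≠ 0) :
    (0 < z.re ∧ 0 < z.im) ∨ (0 < (-z).re ∧ 0 < (-z).im) ∨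
      (0 < (conj z).re ∧ 0 < (conj z).im) ∨ (0 < (-conj z).re ∧ 0 < (-conj z).im) := by
  simp only [neg_re, neg_im, conj_re, conj_im]
  rcases hr.lt_or_gt with h | h <;> rcases hi.lt_or_gt with h' | h' <;> simp [h, h']

theorem ellipseMap_neg_conj (ht0 : 0 < t) (ht1 : t < 1) {z : ℂ} (hz : ‖z‖ < 1 / √t) :
    ellipseMap t (-conj z) = -conj (ellipseMap t z) := by
  rw [ellipseMap_neg, ellipseMap_conj ht0 ht1 hz]

theorem ellipseForm_ellipseMap_lt_one_of_off_axes (ht0 : 0 < t) (ht1 : t < 1) {z : ℂ}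
    (hr : z.re ≠ 0) (hi : z.im ≠ 0) (hz : ‖z‖ < 1) :
    ellipseForm (ellipticMu t / 2) (ellipseMap t z) < 1 := by
  have hz' := hz.trans (one_lt_one_div_sqrt ht0 ht1)
  rcases exists_reflection hr hi with h | h | h | h <;>
  have := ellipseForm_ellipseMap_lt_one_quadrant ht0 ht1 h.1 h.2 (by simpa using hz)
  · exact this
  · rwa [ellipseMap_neg, ellipseForm_neg] at this
  · rwa [ellipseMap_conj ht0 ht1 hz', ellipseForm_conj] at this
  · rwa [ellipseMap_neg_conj ht0 ht1 hz', ellipseForm_neg, ellipseForm_conj] at this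

theorem ellipseForm_ellipseMap_eq_one_of_off_axes (ht0 : 0 < t) (ht1 : t < 1) {z : ℂ}
    (hr : z.re ≠ 0) (hi : z.im ≠ 0) (hz : ‖z‖ = 1) :
    ellipseForm (ellipticMu t / 2) (ellipseMap t z) = 1 := by
  have hz' := hz.trans_lt (one_lt_one_div_sqrt ht0 ht1)
  rcases exists_reflection hr hi with h | h | h | h <;>
  have := ellipseForm_ellipseMap_eq_one_quadrant ht0 ht1 h.1 h.2 (by simpa using hz)
  · exact this
  · rwa [ellipseMap_neg, ellipseForm_neg] at this
  · rwa [ellipseMap_conj ht0 ht1 hz', ellipseForm_conj] at this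
  · rwa [ellipseMap_neg_conj ht0 ht1 hz', ellipseForm_neg, ellipseForm_conj] at this

theorem ellipseMap_sign (ht0 : 0 < t) (ht1 : t < 1) {z : ℂ}
    (hr : z.re ≠ 0) (hi : z.im ≠ 0) (hz : ‖z‖ < 1) :
    (0 < (ellipseMap t z).re ↔ 0 < z.re) ∧ (0 < (ellipseMap t z).im ↔ 0 < z.im) := by
  have hz' := hz.trans (one_lt_one_div_sqrt ht0 ht1)
  rcases exists_reflection hr hi with h | h | h | h <;>
  have := ellipseMap_mem_quadrant ht0 ht1 h.1 h.2 (by simpa using hz.le)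
  · exact ⟨by simp [this, h], by simp [this, h]⟩
  · rw [ellipseMap_neg] at this
    simp only [neg_re, neg_im] at this h
    constructor <;> constructor <;> intro <;> linarith
  · rw [ellipseMap_conj ht0 ht1 hz'] at this
    simp only [conj_re, conj_im] at this h
    constructor <;> constructor <;> intro <;> linarith
  · rw [ellipseMap_neg_conj ht0 ht1 hz'] at this
    simp only [neg_re, neg_im, conj_re, conj_im] at this h
    constructor <;> constructor <;> intro <;> linarith

theorem ellipseMap_injOn_off_axes (ht0 : 0 < t) (ht1 : t < 1) {z w : ℂ}
    (hzr : z.re ≠ 0) (hzi : z.im ≠ 0) (hz : ‖z‖ < 1) (hwr : w.re ≠ 0) (hwi : w.im ≠ 0)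
    (hw : ‖w‖ < 1) (h : ellipseMap t z = ellipseMap t w) : z = w := by
  have hz' := hz.trans (one_lt_one_div_sqrt ht0 ht1)
  have hw' := hw.trans (one_lt_one_div_sqrt ht0 ht1)
  obtain ⟨a1, a2⟩ := ellipseMap_sign ht0 ht1 hzr hzi hz
  obtain ⟨b1, b2⟩ := ellipseMap_sign ht0 ht1 hwr hwi hw
  rw [h] at a1 a2
  have c1 : 0 < z.re ↔ 0 < w.re := a1.symm.trans b1
  have c2 : 0 < z.im ↔ 0 < w.im := a2.symm.trans b2
  have d1 : z.re < 0 ↔ w.re < 0 := by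
    rw [← not_iff_not, not_lt, not_lt, hzr.symm.le_iff_lt, hwr.symm.le_iff_lt, c1]
  have d2 : z.im < 0 ↔ w.im < 0 := by
    rw [← not_iff_not, not_lt, not_lt, hzi.symm.le_iff_lt, hwi.symm.le_iff_lt, c2]
  rcases exists_reflection hzr hzi with g | g | g | g
  · exact ellipseMap_injOn_quadrant ht0 ht1 g.1 g.2 hz.le (c1.1 g.1) (c2.1 g.2) hw.le h
  · refine neg_injective (ellipseMap_injOn_quadrant ht0 ht1 g.1 g.2 (by simpa using hz.le) ?_ ?_
      (by simpa using hw.le) (by rw [ellipseMap_neg, ellipseMap_neg, h]))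
    · simpa [← d1] using g.1
    · simpa [← d2] using g.2
  · refine star_injective (ellipseMap_injOn_quadrant ht0 ht1 (z := conj z) (w := conj w) g.1 g.2
      (by simpa using hz.le) ?_ ?_ (by simpa using hw.le)
      (by rw [ellipseMap_conj ht0 ht1 hz', ellipseMap_conj ht0 ht1 hw', h]))
    · simpa [← c1] using g.1
    · simpa [← d2] using g.2
  · refine star_injective (neg_injective (ellipseMap_injOn_quadrant ht0 ht1 (z := -conj z)
      (w := -conj w) g.1 g.2 (by simpa using hz.le) ?_ ?_ (by simpa using hw.le)
      (by rw [ellipseMap_neg_conj ht0 ht1 hz', ellipseMap_neg_conj ht0 ht1 hw', h])))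
    · simpa [← d1] using g.1
    · simpa [← c2] using g.2

theorem ellipseMap_re_eq_zero (ht0 : 0 < t) (ht1 : t < 1) {z : ℂ} (hz : ‖z‖ < 1) (h : z.re = 0) :
    (ellipseMap t z).re = 0 := by
  have h1 := ellipseMap_neg_conj ht0 ht1 (hz.trans (one_lt_one_div_sqrt ht0 ht1))
  have h2 : -conj z = z := by apply Complex.ext <;> simp [h]
  rw [h2] at h1
  have := congrArg re h1
  simp only [neg_re, conj_re] at this
  linarith

theorem ellipseMap_im_eq_zero (ht0 : 0 < t) (ht1 : t < 1) {z : ℂ} (hz : ‖z‖ < 1) (h : z.im = 0) :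
    (ellipseMap t z).im = 0 := by
  have h1 := ellipseMap_conj ht0 ht1 (hz.trans (one_lt_one_div_sqrt ht0 ht1))
  have h2 : conj z = z := by apply Complex.ext <;> simp [h]
  rw [h2] at h1
  have := congrArg im h1
  simp only [conj_im] at this
  linarith

theorem ball_subset_ball_one_div_sqrt (ht0 : 0 < t) (ht1 : t < 1) :
    Metric.closedBall (0 : ℂ) 1 ⊆ Metric.ball 0 (1 / √t) :=
  Metric.closedBall_subset_ball (one_lt_one_div_sqrt ht0 ht1)

theorem isOpen_image_ellipseMap (ht0 : 0 < t) (ht1 : t < 1) {U : Set ℂ}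
    (hU : U ⊆ Metric.ball 0 1) (hUo : IsOpen U) : IsOpen (ellipseMap t '' U) := by
  have hd : DifferentiableOn ℂ (ellipseMap t) (Metric.ball 0 1) :=
    (differentiableOn_ellipseMap ht0 ht1).mono
      (Metric.ball_subset_closedBall.trans (ball_subset_ball_one_div_sqrt ht0 ht1))
  rcases (hd.analyticOnNhd Metric.isOpen_ball).is_constant_or_isOpen
    (convex_ball 0 1).isPreconnected with ⟨w, hw⟩ | h
  · exfalso
    have h1 := hw 0 (by simp)
    -- Any point of the open quarter disc rules out constancy, as its image has positive real part
    -- while `f(0) = 0`.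
    have h2 := hw ((1 / 2 : ℝ) * (1 + I) / 2) (by
      rw [mem_ball_zero_iff, norm_div, norm_mul, norm_real]
      have := norm_add_le (1 : ℂ) I
      norm_num at this ⊢
      linarith)
    rw [← h1, ellipseMap_zero] at h2
    have h3 := (ellipseMap_mem_quadrant ht0 ht1 (z := (1 / 2 : ℝ) * (1 + I) / 2) (by norm_num)
      (by norm_num) (by
      rw [norm_div, norm_mul, norm_real]
      have := norm_add_le (1 : ℂ) I
      norm_num at this ⊢
      linarith)).1
    rw [h2] at h3
    simp at h3
  · exact h U hU hUo

/-- If `f(a) = f(b)` with `a ≠ b`, disjoint neighbourhoods have open images that overlap, hence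
share a point off the axes. Since `f` maps each axis into itself, its two preimages are off the
axes, where injectivity is known. -/
theorem injOn_ellipseMap (ht0 : 0 < t) (ht1 : t < 1) :
    InjOn (ellipseMap t) (Metric.ball 0 1) := by
  intro a ha b hb h
  by_contra hne
  obtain ⟨U, V, hU, hV, haU, hbV, hUV⟩ := t2_separation hne
  have hU' := isOpen_image_ellipseMap ht0 ht1 (U := U ∩ Metric.ball 0 1) inter_subset_right
    (hU.inter Metric.isOpen_ball)
  have hV' := isOpen_image_ellipseMap ht0 ht1 (U := V ∩ Metric.ball 0 1) inter_subset_right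
    (hV.inter Metric.isOpen_ball)
  have hmem : ellipseMap t a ∈ ellipseMap t '' (U ∩ Metric.ball 0 1) ∩
      ellipseMap t '' (V ∩ Metric.ball 0 1) :=
    ⟨⟨a, ⟨haU, ha⟩, rfl⟩, ⟨b, ⟨hbV, hb⟩, h.symm⟩⟩
  obtain ⟨δ, ⟨⟨a', ⟨ha'U, ha'⟩, e1⟩, ⟨b', ⟨hb'V, hb'⟩, e2⟩⟩, h1, h2⟩ :=
    (((tendsto_off_axes _).eventually ((hU'.inter hV').mem_nhds hmem)).and
      (eventually_off_axes (ellipseMap t a))).exists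
  rw [mem_ball_zero_iff] at ha' hb'
  have : a' = b' := ellipseMap_injOn_off_axes ht0 ht1
    (fun h0 => h1 (e1 ▸ ellipseMap_re_eq_zero ht0 ht1 ha' h0))
    (fun h0 => h2 (e1 ▸ ellipseMap_im_eq_zero ht0 ht1 ha' h0)) ha'
    (fun h0 => h1 (e2 ▸ ellipseMap_re_eq_zero ht0 ht1 hb' h0))
    (fun h0 => h2 (e2 ▸ ellipseMap_im_eq_zero ht0 ht1 hb' h0)) hb' (e1.trans e2.symm)
  exact disjoint_left.1 hUV ha'U (this ▸ hb'V)

theorem continuousOn_ellipseForm_ellipseMap (ht0 : 0 < t) (ht1 : t < 1) :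
    ContinuousOn (fun z => ellipseForm (ellipticMu t / 2) (ellipseMap t z))
      (Metric.ball 0 (1 / √t)) :=
  (continuous_ellipseForm _).comp_continuousOn (differentiableOn_ellipseMap ht0 ht1).continuousOn

theorem ellipseForm_ellipseMap_sphere (ht0 : 0 < t) (ht1 : t < 1) {z : ℂ} (hz : ‖z‖ = 1) :
    ellipseForm (ellipticMu t / 2) (ellipseMap t z) = 1 := by
  by_cases h : z.re ≠ 0 ∧ z.im ≠ 0
  · exact ellipseForm_ellipseMap_eq_one_of_off_axes ht0 ht1 h.1 h.2 hz
  -- Lying on an axis means that `z²` is real; a small rotation of `z` makes it non-real, and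
  -- continuity along the circle concludes.
  have hsq : (z ^ 2).im = 0 := by
    rw [not_and_or, not_not, not_not] at h
    rcases h with h | h <;> simp [sq, h]
  have hsqr : (z ^ 2).re ≠ 0 := fun h0 => by
    have : z ^ 2 = 0 := Complex.ext h0 hsq
    rw [pow_eq_zero_iff two_ne_zero] at this
    simp [this] at hz
  have hT : Tendsto (fun δ : ℝ => z * exp (δ * I)) (𝓝[>] 0) (𝓝 z) := by
    have : Continuous fun δ : ℝ => z * exp (δ * I) := by fun_prop
    have h := this.tendsto 0
    simp only [ofReal_zero, zero_mul, exp_zero, mul_one] at h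
    exact h.mono_left nhdsWithin_le_nhds
  have hc : ContinuousAt (fun z => ellipseForm (ellipticMu t / 2) (ellipseMap t z)) z :=
    (continuousOn_ellipseForm_ellipseMap ht0 ht1).continuousAt (Metric.isOpen_ball.mem_nhds
      (ball_subset_ball_one_div_sqrt ht0 ht1 (by simp [hz])))
  refine tendsto_nhds_unique (hc.tendsto.comp hT)
    (tendsto_const_nhds.congr' ?_)
  filter_upwards [Ioo_mem_nhdsGT (show (0 : ℝ) < π / 2 by positivity)] with δ hδ
  have him : ((z * exp (δ * I)) ^ 2).im ≠ 0 := by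
    have e : exp ((δ : ℂ) * I) ^ 2 = exp ((2 * δ : ℝ) * I) := by
      rw [← exp_nat_mul]; congr 1; push_cast; ring
    rw [mul_pow, e, mul_im, hsq, zero_mul, add_zero, exp_ofReal_mul_I_im]
    exact mul_ne_zero hsqr (Real.sin_pos_of_mem_Ioo ⟨by linarith [hδ.1], by linarith [hδ.2]⟩).ne'
  rw [sq, mul_im] at him
  refine (ellipseForm_ellipseMap_eq_one_of_off_axes ht0 ht1 ?_ ?_ ?_).symm
  · intro h0; rw [h0] at him; simp at him
  · intro h0; rw [h0] at him; simp at him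
  · rw [norm_mul, hz, norm_exp_ofReal_mul_I, one_mul]

/-- Continuity from off the axes gives only `≤ 1`. Equality is excluded by openness of the image,
which would contain `(1 + δ) f(z)` for some `δ > 0`. -/
theorem ellipseForm_ellipseMap_lt_one (ht0 : 0 < t) (ht1 : t < 1) {z : ℂ} (hz : ‖z‖ < 1) :
    ellipseForm (ellipticMu t / 2) (ellipseMap t z) < 1 := by
  have hle : ∀ z : ℂ, ‖z‖ < 1 → ellipseForm (ellipticMu t / 2) (ellipseMap t z) ≤ 1 := by
    intro z hz
    have hzb : z ∈ Metric.ball (0 : ℂ) 1 := by simpa using hz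
    have hc : ContinuousAt (fun z => ellipseForm (ellipticMu t / 2) (ellipseMap t z)) z :=
      (continuousOn_ellipseForm_ellipseMap ht0 ht1).continuousAt (Metric.isOpen_ball.mem_nhds
        (ball_subset_ball_one_div_sqrt ht0 ht1 (Metric.ball_subset_closedBall hzb)))
    refine le_of_tendsto (hc.tendsto.comp (tendsto_off_axes z)) ?_
    filter_upwards [eventually_off_axes z,
      (tendsto_off_axes z).eventually (Metric.isOpen_ball.mem_nhds hzb)] with δ h1 h2
    exact (ellipseForm_ellipseMap_lt_one_of_off_axes ht0 ht1 h1.1 h1.2 (by simpa using h2)).le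
  have hopen := isOpen_image_ellipseMap ht0 ht1 subset_rfl Metric.isOpen_ball
  have hT : Tendsto (fun δ : ℝ => ((1 + δ : ℝ) : ℂ) * ellipseMap t z) (𝓝[>] 0)
      (𝓝 (ellipseMap t z)) := by
    have : Continuous fun δ : ℝ => ((1 + δ : ℝ) : ℂ) * ellipseMap t z := by fun_prop
    have h := this.tendsto 0
    simp only [add_zero, ofReal_one, one_mul] at h
    exact h.mono_left nhdsWithin_le_nhds
  obtain ⟨δ, ⟨z', hz', e⟩, hδ⟩ := ((hT.eventually (hopen.mem_nhds
    ⟨z, by simpa using hz, rfl⟩)).and self_mem_nhdsWithin).exists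
  have h1 := hle z' (by simpa using hz')
  rw [e, ellipseForm_smul] at h1
  have h2 : (1 : ℝ) < (1 + δ) ^ 2 := by
    have : (0 : ℝ) < δ := hδ
    nlinarith
  nlinarith [ellipseForm_nonneg (ellipticMu t / 2) (ellipseMap t z)]

theorem image_ellipseMap (ht0 : 0 < t) (ht1 : t < 1) :
    ellipseMap t '' Metric.ball 0 1 = ellipseRegion (ellipticMu t / 2) := by
  refine Subset.antisymm ?_ ?_
  · rintro _ ⟨z, hz, rfl⟩
    exact ellipseForm_ellipseMap_lt_one ht0 ht1 (by simpa using hz)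
  · have h0 : (0 : ℂ) ∈ ellipseRegion (ellipticMu t / 2) := by simp [ellipseRegion]
    refine ((starConvex_ellipseRegion _).isPathConnected h0).isConnected.isPreconnected
      |>.subset_of_closure_inter_subset
      (isOpen_image_ellipseMap ht0 ht1 subset_rfl Metric.isOpen_ball)
      ⟨0, h0, 0, by simp, ellipseMap_zero⟩ ?_
    rintro w ⟨hw, hwE⟩
    have hcomp : IsCompact (ellipseMap t '' Metric.closedBall 0 1) :=
      (isCompact_closedBall 0 1).image_of_continuousOn
        ((differentiableOn_ellipseMap ht0 ht1).continuousOn.mono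
          (ball_subset_ball_one_div_sqrt ht0 ht1))
    obtain ⟨z, hz, rfl⟩ := closure_minimal (image_mono Metric.ball_subset_closedBall)
      hcomp.isClosed hw
    refine ⟨z, ?_, rfl⟩
    rw [mem_closedBall_zero_iff] at hz
    rw [mem_ball_zero_iff]
    refine lt_of_le_of_ne hz fun h1 => ?_
    rw [mem_ellipseRegion, ellipseForm_ellipseMap_sphere ht0 ht1 h1] at hwE
    exact lt_irrefl _ hwE

end

/-! ### Taylor coefficients and the two sums -/

section

theorem iteratedDeriv_conj_conj (f : ℂ → ℂ) (n : ℕ) :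
    iteratedDeriv n (conj ∘ f ∘ conj) = conj ∘ iteratedDeriv n f ∘ conj := by
  induction n with
  | zero => simp [iteratedDeriv_zero]
  | succ n ih => rw [iteratedDeriv_succ, ih, deriv_conj_conj, ← iteratedDeriv_succ]

theorem circleAverage_re_of_differentiableOn {g : ℂ → ℂ} {R : ℝ} (hR : 1 < R)
    (hg : DifferentiableOn ℂ g (Metric.ball 0 R)) {φ : ℂ → ℝ}
    (h : ∀ z : ℂ, ‖z‖ = 1 → φ z = (g z).re) : Real.circleAverage φ 0 1 = (g 0).re := by
  have hsub : Metric.closedBall (0 : ℂ) 1 ⊆ Metric.ball 0 R := Metric.closedBall_subset_ball hR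
  have h1 : Real.circleAverage φ 0 1 = Real.circleAverage (reCLM ∘ g) 0 1 := by
    refine Real.circleAverage_congr_sphere fun z hz => ?_
    simpa using h z (by simpa using hz)
  have h2 : ContinuousOn g (Metric.sphere 0 |1|) := by
    rw [abs_one]
    exact hg.continuousOn.mono (Metric.sphere_subset_closedBall.trans hsub)
  have h3 : Real.circleAverage g 0 1 = g 0 := by
    refine DiffContOnCl.circleAverage ?_
    rw [abs_one]
    exact (hg.mono hsub).diffContOnCl_ball subset_rfl
  rw [h1, reCLM.circleAverage_comp_comm (h2.circleIntegrable'), h3, reCLM_apply]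

/-- The equation of the ellipse is an affine relation between `(Re w)²` and `(Im w)²`, so `|w|²` is
an affine function of `Re (w²)` there. -/
theorem normSq_of_ellipseForm_eq_one {μ : ℝ} (hμ : 0 < μ) {w : ℂ}
    (hw : ellipseForm (μ / 2) w = 1) :
    ‖w‖ ^ 2 = ((w ^ 2 + (Real.sinh μ ^ 2 / 2 : ℝ)) / (Real.cosh μ : ℝ)).re := by
  have hC := Real.cosh_pos (μ / 2)
  have hS := Real.sinh_pos_iff.2 (half_pos hμ)
  have hcs := Real.cosh_sq (μ / 2)
  have hc : Real.cosh μ = Real.cosh (μ / 2) ^ 2 + Real.sinh (μ / 2) ^ 2 := by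
    rw [← Real.cosh_two_mul]; congr 1; ring
  have hs : Real.sinh μ = 2 * Real.sinh (μ / 2) * Real.cosh (μ / 2) := by
    rw [← Real.sinh_two_mul]; congr 1; ring
  rw [div_ofReal_re, eq_div_iff (Real.cosh_pos μ).ne', add_re, ofReal_re, sq w, mul_re,
    ← normSq_eq_norm_sq, normSq_apply, hc, hs]
  rw [ellipseForm, div_add_div _ _ (by positivity) (by positivity), div_eq_one_iff_eq
    (by positivity)] at hw
  rw [hcs] at hw ⊢
  linear_combination 2 * hw - 2 * Real.sinh (μ / 2) ^ 2 * hcs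

/-- With `w² = P + iQ`, square the previous identity, double it, and remove `P²` using `|w|⁴ = P² +
Q²` and `Re w⁴ = P² - Q²`. -/
theorem norm_pow_four_of_ellipseForm_eq_one {μ : ℝ} (hμ : 0 < μ) {w : ℂ}
    (hw : ellipseForm (μ / 2) w = 1) :
    ‖w ^ 2‖ ^ 2 = ((w ^ 4 + (2 * Real.sinh μ ^ 2 : ℝ) * w ^ 2 + (Real.sinh μ ^ 4 / 2 : ℝ)) /
      (Real.cosh (2 * μ) : ℝ)).re := by
  have h1 := normSq_of_ellipseForm_eq_one hμ hw
  have hc := Real.cosh_pos μ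
  rw [div_ofReal_re, eq_div_iff hc.ne', add_re, ofReal_re] at h1
  have h2 : ‖w‖ ^ 4 = (w ^ 2).re ^ 2 + (w ^ 2).im ^ 2 := by
    have : ‖w‖ ^ 4 = ‖w ^ 2‖ ^ 2 := by rw [norm_pow]; ring
    rw [this, ← normSq_eq_norm_sq, normSq_apply]; ring
  have h3 : (w ^ 4).re = (w ^ 2).re ^ 2 - (w ^ 2).im ^ 2 := by
    have : w ^ 4 = w ^ 2 * w ^ 2 := by ring
    rw [this, mul_re]; ring
  have h4 : Real.cosh (2 * μ) = 2 * Real.cosh μ ^ 2 - 1 := by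
    rw [Real.cosh_two_mul, Real.sinh_sq]; ring
  rw [div_ofReal_re, eq_div_iff (Real.cosh_pos _).ne', add_re, add_re, ofReal_re, re_ofReal_mul,
    norm_pow, h4, h3]
  generalize (w ^ 2).re = P at *
  generalize (w ^ 2).im = Q at *
  have h5 : (‖w‖ ^ 2) ^ 2 * Real.cosh μ ^ 2 = (P + Real.sinh μ ^ 2 / 2) ^ 2 := by
    rw [← mul_pow, h1]
  linear_combination 2 * h5 - h2

variable {t : ℝ}

theorem ellipseCoeff_even (n : ℕ) : ellipseCoeff t (2 * n) = 0 := by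
  have h := iteratedDeriv_comp_neg (2 * n) (ellipseMap t) 0
  simp only [ellipseMap_neg, neg_zero, pow_mul, neg_one_sq, one_pow, one_smul] at h
  rw [iteratedDeriv_fun_neg] at h
  rw [ellipseCoeff, self_eq_neg.1 h.symm, zero_div]

theorem ellipseCoeff_conj (ht0 : 0 < t) (ht1 : t < 1) (n : ℕ) :
    conj (ellipseCoeff t n) = ellipseCoeff t n := by
  have h1 : conj ∘ ellipseMap t ∘ conj =ᶠ[𝓝 0] ellipseMap t := by
    filter_upwards [Metric.ball_mem_nhds (0 : ℂ)
      (zero_lt_one.trans (one_lt_one_div_sqrt ht0 ht1))] with z hz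
    simp [ellipseMap_conj ht0 ht1 (by simpa using hz)]
  have h2 := h1.iteratedDeriv_eq n
  rw [iteratedDeriv_conj_conj] at h2
  simp only [Function.comp_apply, map_zero] at h2
  rw [ellipseCoeff, map_div₀, h2, Complex.conj_natCast]

theorem ellipseCoeff_odd (ht0 : 0 < t) (ht1 : t < 1) (n : ℕ) :
    ellipseCoeff t (2 * n + 1) = (ellipseA t n : ℂ) :=
  (conj_eq_iff_re.1 (ellipseCoeff_conj ht0 ht1 _)).symm

theorem hasSum_ellipseMap (ht0 : 0 < t) (ht1 : t < 1) {z : ℂ} (hz : ‖z‖ < 1 / √t) :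
    HasSum (fun n : ℕ => (ellipseA t n : ℂ) * z ^ (2 * n + 1)) (ellipseMap t z) := by
  have h := hasSum_taylorSeries_on_ball (differentiableOn_ellipseMap ht0 ht1)
    (z := z) (by simpa using hz)
  have h2 : HasSum (fun n : ℕ => ellipseCoeff t n * z ^ n) (ellipseMap t z) := by
    refine (congrArg (HasSum · _) (funext fun n => ?_)).mpr h
    rw [ellipseCoeff, sub_zero, smul_eq_mul, smul_eq_mul]
    ring
  have hinj : Function.Injective fun n : ℕ => 2 * n + 1 := fun a b hab => by simpa using hab
  rw [← hinj.hasSum_iff] at h2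
  · convert h2 using 2 with n
    simp [ellipseCoeff_odd ht0 ht1]
  · intro n hn
    rcases Nat.even_or_odd' n with ⟨k, rfl | rfl⟩
    · rw [ellipseCoeff_even, zero_mul]
    · exact absurd ⟨k, rfl⟩ hn

/-- The Taylor series converges on a disc containing `z = 1`, which is what makes Parseval on the
unit circle available. -/
theorem summable_norm_ellipseA (ht0 : 0 < t) (ht1 : t < 1) :
    Summable fun n => ‖(ellipseA t n : ℂ)‖ := by
  simpa using (hasSum_ellipseMap ht0 ht1 (z := 1)
    (by simpa using one_lt_one_div_sqrt ht0 ht1)).summable.norm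

theorem hasSum_ellipseA_sq (ht0 : 0 < t) (ht1 : t < 1) :
    HasSum (fun n : ℕ => ellipseA t n ^ 2)
      (Real.sinh (ellipticMu t) ^ 2 / (2 * Real.cosh (ellipticMu t))) := by
  have h1 := hasSum_sq_norm_coeff (e := fun n => 2 * n + 1) (fun a b hab => by simpa using hab)
    (summable_norm_ellipseA ht0 ht1) fun z hz => hasSum_ellipseMap ht0 ht1
      (by rw [mem_sphere_zero_iff_norm.1 hz]; exact one_lt_one_div_sqrt ht0 ht1)
  have hd := differentiableOn_ellipseMap ht0 ht1
  rw [circleAverage_re_of_differentiableOn (one_lt_one_div_sqrt ht0 ht1)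
    (g := fun z => (ellipseMap t z ^ 2 + (Real.sinh (ellipticMu t) ^ 2 / 2 : ℝ)) /
      (Real.cosh (ellipticMu t) : ℝ)) (((hd.pow 2).add_const _).div_const _) fun z hz =>
      normSq_of_ellipseForm_eq_one (ellipticMu_pos ht0 ht1)
        (ellipseForm_ellipseMap_sphere ht0 ht1 hz)] at h1
  convert h1 using 1
  · ext n; simp
  · rw [ellipseMap_zero, zero_pow two_ne_zero, zero_add, ← ofReal_div, ofReal_re, div_div]

theorem hasSum_ellipseMap_sq (ht0 : 0 < t) (ht1 : t < 1) {z : ℂ} (hz : ‖z‖ < 1 / √t) :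
    HasSum (fun n : ℕ => ((∑ j ∈ Finset.range (n + 1), ellipseA t j * ellipseA t (n - j) : ℝ) : ℂ) *
      z ^ (2 * n + 2)) (ellipseMap t z ^ 2) := by
  have h := hasSum_ellipseMap ht0 ht1 hz
  have hn := h.summable.norm
  have h2 := hasSum_sum_range_mul_of_summable_norm hn hn
  rw [h.tsum_eq, ← sq] at h2
  refine (congrArg (HasSum · _) (funext fun n => ?_)).mpr h2
  push_cast
  rw [Finset.sum_mul]
  refine Finset.sum_congr rfl fun j hj => ?_
  have hj' : j ≤ n := Nat.lt_succ_iff.1 (Finset.mem_range.1 hj)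
  have e : 2 * n + 2 = (2 * j + 1) + (2 * (n - j) + 1) := by omega
  rw [e, pow_add]
  ring

/-- The inner sums are the Taylor coefficients of `f²`, so this is Parseval for `f²` followed by the
mean value property. -/
theorem hasSum_cauchy_ellipseA_sq (ht0 : 0 < t) (ht1 : t < 1) :
    HasSum (fun n : ℕ => (∑ j ∈ Finset.range (n + 1), ellipseA t j * ellipseA t (n - j)) ^ 2)
      (Real.sinh (ellipticMu t) ^ 4 / (2 * Real.cosh (2 * ellipticMu t))) := by
  have hn := (hasSum_ellipseMap_sq ht0 ht1 (z := 1)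
    (by simpa using one_lt_one_div_sqrt ht0 ht1)).summable.norm
  simp only [one_pow, mul_one] at hn
  have h1 := hasSum_sq_norm_coeff (e := fun n => 2 * n + 2) (fun a b hab => by simpa using hab)
    hn fun z hz => hasSum_ellipseMap_sq ht0 ht1
      (by rw [mem_sphere_zero_iff_norm.1 hz]; exact one_lt_one_div_sqrt ht0 ht1)
  have hd := differentiableOn_ellipseMap ht0 ht1
  rw [circleAverage_re_of_differentiableOn (one_lt_one_div_sqrt ht0 ht1)
    (g := fun z => (ellipseMap t z ^ 4 + (2 * Real.sinh (ellipticMu t) ^ 2 : ℝ) *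
      ellipseMap t z ^ 2 + (Real.sinh (ellipticMu t) ^ 4 / 2 : ℝ)) /
      (Real.cosh (2 * ellipticMu t) : ℝ))
    ((((hd.pow 4).add ((hd.pow 2).const_mul _)).add_const _).div_const _) fun z hz =>
      norm_pow_four_of_ellipseForm_eq_one (ellipticMu_pos ht0 ht1)
        (ellipseForm_ellipseMap_sphere ht0 ht1 hz)] at h1
  convert h1 using 1
  · ext n
    rw [norm_real, Real.norm_eq_abs, sq_abs]
  · rw [ellipseMap_zero, zero_pow two_ne_zero, zero_pow four_ne_zero, mul_zero, zero_add, zero_add,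
      ← ofReal_div, ofReal_re, div_div]

end
end

theorem mainTheorem8 (t : ℝ) (ht0 : 0 < t) (ht1 : t < 1) :
    -- `f_{0,t}` is the conformal map of the unit disc onto the ellipse `V_ξ`, `2ξ = μ(t)`,
    -- normalized by `f(0) = 0`, `f'(0) > 0`
    (DifferentiableOn ℂ (ellipseMap t) (Metric.ball 0 1) ∧
      Set.InjOn (ellipseMap t) (Metric.ball 0 1) ∧
      ellipseMap t '' Metric.ball 0 1 = ellipseRegion (ellipticMu t / 2) ∧
      ellipseMap t 0 = 0 ∧
      (∃ c : ℝ, 0 < c ∧ HasDerivAt (ellipseMap t) (c : ℂ) 0)) ∧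
    -- its Taylor coefficients: the even ones vanish and the odd ones are the real `A_n(t)`
    (∀ n : ℕ, ellipseCoeff t (2 * n) = 0 ∧ ellipseCoeff t (2 * n + 1) = (ellipseA t n : ℂ)) ∧
    (∀ z ∈ Metric.ball (0 : ℂ) 1,
      HasSum (fun n : ℕ => (ellipseA t n : ℂ) * z ^ (2 * n + 1)) (ellipseMap t z)) ∧
    -- the two sums
    HasSum (fun n : ℕ => ellipseA t n ^ 2)
      (Real.sinh (ellipticMu t) ^ 2 / (2 * Real.cosh (ellipticMu t))) ∧
    HasSum (fun n : ℕ => (∑ j ∈ Finset.range (n + 1), ellipseA t j * ellipseA t (n - j)) ^ 2)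
      (Real.sinh (ellipticMu t) ^ 4 / (2 * Real.cosh (2 * ellipticMu t))) := by
  have hK := completeEllipticK_pos ht0 ht1
  have hpi := Real.pi_pos
  refine ⟨⟨(differentiableOn_ellipseMap ht0 ht1).mono (Metric.ball_subset_closedBall.trans
    (ball_subset_ball_one_div_sqrt ht0 ht1)), injOn_ellipseMap ht0 ht1, image_ellipseMap ht0 ht1,
    ellipseMap_zero, _, ?_, hasDerivAt_ellipseMap_zero ht0 ht1⟩,
    fun n => ⟨ellipseCoeff_even n, ellipseCoeff_odd ht0 ht1 n⟩, fun z hz => ?_,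
    hasSum_ellipseA_sq ht0 ht1, hasSum_cauchy_ellipseA_sq ht0 ht1⟩
  · positivity
  · exact hasSum_ellipseMap ht0 ht1
      ((mem_ball_zero_iff.1 hz).trans (one_lt_one_div_sqrt ht0 ht1))
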